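/- Let $\Sigma$ be a finite alphabet containing two distinct letters $0,1$; $\Sigma^*$ (finite words) carries the discrete topology and $\Sigma^\omega$ (infinite sequences) the Cantor topology. A multi-function $f:A\rightrightarrows B$ assigns to every $a\in A$ a set $f(a)\subseteq B$, and $\mathrm{dom}(f)=\{a\mid f(a)\neq\emptyset\}$; it is a partial function if every $f(a)$ has at most one element. A partial function is \emph{continuous} if it is continuous on its domain with the subspace topology. A partial function $f:\subseteq Z_1\times\dots\times Z_n\to Z_0$ with all $Z_j\in\{\Sigma^*,\Sigma^\omega\}$ is \emph{computable} if it has an extension that is the function computed by some Type-2 machine, i.e. by a deterministic multi-tape Turing machine with $n$ input tapes, finitely many work tapes and a one-way output tape (output $w\in\Sigma^*$: the machine halts with $w$ on the output tape; output $q\in\Sigma^\omega$: the machine computes forever and writes $q$). A \emph{generalized Turing machine} (GTM) has Tapes $0,\dots,L$ (Tapes $1,\dots,k$ for input, $0\le k\le L$, Tape $0$ for output), a finite set of labels with an initial label $l_0$ and a final label $l_f$, a finite work alphabet $\Gamma$ with a blank, and sets $Y_0,\dots,Y_L$ disjoint from $\Gamma$; each cell (indexed by $\mathbb Z$) of Tape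 $i$ holds an element of $Y_i\cup\Gamma$. Every label $l\neq l_f$ carries one statement: move the head of Tape $i$ one cell right or left and go to $l'$; write $a\in\Gamma$ on the scanned cell of Tape $i$ and go to $l'$; go to $l'$ if $a\in\Gamma$ is scanned on Tape $i$, else to $l''$; write some element of $f(x_{i_1},\dots,x_{i_n})$ on the scanned cell of Tape $i$ and go to $l'$, where $f:Y_{i_1}\times\dots\times Y_{i_n}\rightrightarrows Y_i$ is a multi-function and $x_j$ is the content of the scanned cell of Tape $j$; go to $l'$ if $f(x_{i_1},\dots,x_{i_n})=0$ and to $l''$ if it is $1$, where $f:\subseteq Y_{i_1}\times\dots\times Y_{i_n}\to\Sigma^*$ is a partial function with range in $\{0,1\}$. If the statement cannot be executed there is no successor configuration, and neither is there one at $l_f$. On input $(x_1,\dots,x_k)\in Y_1\times\dots\times Y_k$ the machine starts with label $l_0$, all heads at position $0$, $x_i$ in cell $0$ of Tape $i$ ($1\le i\le k$), and all other cells blank. A configuration is accepting if its label is $l_f$ and cell $0$ of Tape $0$ contains an element of $Y_0$ (its result); a computation is accepting if it is finite and ends in an accepting configuration. The multi-function $f_N:Y_1\times\dots\times Y_k\rightrightarrows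 Y_0$ computed by a GTM $N$ is defined by: $x_0\in f_N(x_1,\dots,x_k)$ iff every maximal computation of $N$ on this input is accepting and some accepting computation on this input has the result $x_0$. \textbf{Claim.} Let $N$ be a GTM such that $Y_i\in\{\Sigma^*,\Sigma^\omega\}$ for $0\le i\le L$. (1) If all functions used in the statements of $N$ (in assignments and in tests) are continuous partial functions, then $f_N$ is a continuous partial function. (2) If all functions used in the statements of $N$ are computable partial functions, then $f_N$ is a computable partial function. -/

import Mathlib

namespace GenTM

/-! Multi-functions -/

/-- A multi-function `A ⇉ B`, given by the set `f a` of acceptable results at every `a`.  A partial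
function is a multi-function that is single-valued. -/
def MultiFun (A B : Type) : Type := A → Set B

namespace MultiFun

variable {A B : Type}

/-- The domain: all points at which there is some result. -/
def dom (f : MultiFun A B) : Set A := {a | (f a).Nonempty}

/-- `f` is a partial function. -/
def SingleValued (f : MultiFun A B) : Prop := ∀ a, (f a).Subsingleton

/-- The partial function `f` is continuous, i.e. it is single-valued, and continuous on its domain,
which carries the subspace topology. -/
def IsContinuous [TopologicalSpace A] [TopologicalSpace B] (f : MultiFun A B) : Prop :=
  f.SingleValued ∧ ∃ g : f.dom → B, Continuous g ∧ ∀ a : f.dom, g a ∈ f a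

end MultiFun

/-! Finite and infinite sequences over an alphabet -/

/-- The two kinds of sequence spaces. -/
inductive Kind
  | word
  | stream

/-- The set of finite words, respectively of infinite sequences, over the alphabet `S`. -/
def Str (S : Type) : Kind → Type
  | .word => List S
  | .stream => ℕ → S

/-- The discrete topology on words; the Cantor topology (the product of the discrete topologies) on
infinite sequences. -/
instance Str.topology (S : Type) : (t : Kind) → TopologicalSpace (Str S t)
  | .word => (⊥ : TopologicalSpace (List S))
  | .stream => @Pi.topologicalSpace ℕ (fun _ => S) (fun _ => ⊥)

/-- The inscription of a two-way infinite tape that holds the given sequence from cell `0` on;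
`none` is the blank. -/
def Str.symbolAt {S : Type} : {t : Kind} → Str S t → ℤ → Option S
  | .word, w, z => if 0 ≤ z then (show List S from w)[z.toNat]? else none
  | .stream, p, z => if 0 ≤ z then some ((show ℕ → S from p) z.toNat) else none

/-- A single letter as a word. -/
def letter {S : Type} (a : S) : Str S .word := ([a] : List S)

/-! Type-2 machines -/

/-- What a Type-2 machine does in one step: next state, motion of the heads on the input tapes
(`none` = stay), symbols written on the work tapes, motion of the heads on the work tapes, and
possibly a symbol that is appended to the output. -/
structure Action (S State Work : Type) (n m : ℕ) where
  next : State
  inMove : Fin n → Option Turing.Dir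
  write : Fin m → Work
  workMove : Fin m → Option Turing.Dir
  out : Option S

/-- A deterministic multi-tape machine with finite control, `n` (read-only) input tapes, finitely
many work tapes over a finite work alphabet (with blank symbol `default`), and a one-way output tape
over `S`.  In every step the machine sees its state and the scanned symbols on the input and the
work tapes; it halts where `δ` is `none`. -/
structure Type2Machine (S : Type) (n : ℕ) where
  State : Type
  [finState : Finite State]
  Work : Type
  [finWork : Finite Work]
  [blank : Inhabited Work]
  numWork : ℕ
  start : State
  δ : State → (Fin n → Option S) → (Fin numWork → Work) → Option (Action S State Work n numWork)

namespace Type2Machine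

variable {S : Type} {n : ℕ}

attribute [instance] Type2Machine.finState Type2Machine.finWork Type2Machine.blank

/-- Configurations; `out` is the word written so far on the output tape. -/
structure Cfg (M : Type2Machine S n) where
  state : M.State
  inHead : Fin n → ℤ
  work : Fin M.numWork → Turing.Tape M.Work
  out : List S

/-- Displacement of a head. -/
def shift : Option Turing.Dir → ℤ
  | none => 0
  | some .left => -1
  | some .right => 1

/-- Motion of a work tape relative to its head. -/
def moveTape {G : Type} [Inhabited G] : Option Turing.Dir → Turing.Tape G → Turing.Tape G
  | none, T => T
  | some d, T => T.move d

variable (M : Type2Machine S n) {Y : Fin n → Kind}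

/-- All heads at cell `0`, work tapes blank, nothing written. -/
def init : M.Cfg :=
  ⟨M.start, fun _ => 0, fun _ => default, []⟩

/-- One step on the input `p`. -/
def step (p : ∀ j, Str S (Y j)) (c : M.Cfg) : Option M.Cfg :=
  (M.δ c.state (fun j => (p j).symbolAt (c.inHead j)) (fun r => (c.work r).head)).map fun a =>
    { state := a.next
      inHead := fun j => c.inHead j + shift (a.inMove j)
      work := fun r => moveTape (a.workMove r) ((c.work r).write (a.write r))
      out := c.out ++ a.out.toList }

/-- The configuration after `s` steps on the input `p`, if the machine makes that many steps. -/
def run (p : ∀ j, Str S (Y j)) : ℕ → Option M.Cfg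
  | 0 => some M.init
  | s + 1 => (run p s).bind (M.step p)

/-- The function computed by the machine with the type specification `(Y₁, …, Yₙ → Y₀)`.
For words as output: the machine halts with `w` on the output tape.
For infinite sequences as output: the machine computes forever and writes `q`. -/
def fn (Y : Fin n → Kind) : (Y₀ : Kind) → MultiFun (∀ j, Str S (Y j)) (Str S Y₀)
  | .word => fun p => {w | ∃ s c, M.run p s = some c ∧ M.step p c = none ∧ c.out = w}
  | .stream => fun p => {q : ℕ → S | (∀ s, M.run p s ≠ none) ∧
      ∀ m, ∃ s c, M.run p s = some c ∧ c.out[m]? = some (q m)}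

end Type2Machine

/-- `f` is the function of some Type-2 machine. -/
def IsTuringComputable {S : Type} {n : ℕ} (Y : Fin n → Kind) (Y₀ : Kind)
    (f : MultiFun (∀ j, Str S (Y j)) (Str S Y₀)) : Prop :=
  ∃ M : Type2Machine S n, f = M.fn Y Y₀

/-- The partial function `f` is computable, i.e. has a Turing computable extension. -/
def IsComputable {S : Type} {n : ℕ} (Y : Fin n → Kind) (Y₀ : Kind)
    (f : MultiFun (∀ j, Str S (Y j)) (Str S Y₀)) : Prop :=
  f.SingleValued ∧ ∃ g, IsTuringComputable Y Y₀ g ∧ ∀ p, f p ⊆ g p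

/-! Generalized Turing machines -/

/-- The statements of a generalized Turing machine with tapes `0, …, L`, labels `Lab`, work alphabet
`Γ`, and the set `X i` associated with Tape `i`.  `zero` and `one` are the letters `0, 1` of the
alphabet `S`, with the words `0` (true) and `1` (false) as results of tests. -/
inductive Stm {S : Type} (zero one : S) (Lab Γ : Type) {L : ℕ} (X : Fin (L + 1) → Type) : Type
  | right (i : Fin (L + 1)) (l' : Lab)
  | left (i : Fin (L + 1)) (l' : Lab)
  | write (i : Fin (L + 1)) (a : Γ) (l' : Lab)
  | branch (i : Fin (L + 1)) (a : Γ) (l' l'' : Lab)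
  | assign (i : Fin (L + 1)) {n : ℕ} (is : Fin n → Fin (L + 1))
      (f : MultiFun (∀ j, X (is j)) (X i)) (l' : Lab)
  | test {n : ℕ} (is : Fin n → Fin (L + 1)) (f : MultiFun (∀ j, X (is j)) (Str S .word))
      (singleValued : f.SingleValued) (range_sub : ∀ x, f x ⊆ {letter zero, letter one})
      (l' l'' : Lab)

/-- A generalized Turing machine: Tapes `1, …, k` are the input tapes, Tape `0` is the output tape.
A cell of Tape `i` contains an element of the disjoint union of `X i` and the work alphabet. -/
structure GTM {S : Type} (zero one : S) (k L : ℕ) (X : Fin (L + 1) → Type) where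
  k_le : k ≤ L
  Lab : Type
  [finLab : Finite Lab]
  start : Lab
  final : Lab
  Γ : Type
  [finΓ : Finite Γ]
  blank : Γ
  stm : {l : Lab // l ≠ final} → Stm zero one Lab Γ X

namespace GTM

variable {S : Type} {zero one : S} {k L : ℕ} {X : Fin (L + 1) → Type}

/-- Configurations: label, tape inscriptions, head positions. -/
structure Cfg (M : GTM zero one k L X) where
  label : M.Lab
  tape : ∀ i, ℤ → X i ⊕ M.Γ
  head : Fin (L + 1) → ℤ

variable {M : GTM zero one k L X}

/-- The content of the cell scanned by the head on Tape `i`. -/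
def Cfg.scan (κ : M.Cfg) (i : Fin (L + 1)) : X i ⊕ M.Γ := κ.tape i (κ.head i)

def Cfg.setLabel (κ : M.Cfg) (l : M.Lab) : M.Cfg := { κ with label := l }

def Cfg.setHead (κ : M.Cfg) (i : Fin (L + 1)) (m : ℤ) : M.Cfg :=
  { κ with head := Function.update κ.head i m }

/-- Write `x` under the head of Tape `i`. -/
def Cfg.setCell (κ : M.Cfg) (i : Fin (L + 1)) (x : X i ⊕ M.Γ) : M.Cfg :=
  { κ with tape := Function.update κ.tape i (Function.update (κ.tape i) (κ.head i) x) }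

variable (M)

/-- The successor relation for one statement. -/
def StmStep (κ κ' : M.Cfg) : Stm zero one M.Lab M.Γ X → Prop
  | .right i l' => κ' = (κ.setHead i (κ.head i + 1)).setLabel l'
  | .left i l' => κ' = (κ.setHead i (κ.head i - 1)).setLabel l'
  | .write i a l' => κ' = (κ.setCell i (.inr a)).setLabel l'
  | .branch i a l' l'' =>
      (κ.scan i = .inr a ∧ κ' = κ.setLabel l') ∨ (κ.scan i ≠ .inr a ∧ κ' = κ.setLabel l'')
  | .assign i is f l' =>
      ∃ x : ∀ j, X (is j), (∀ j, κ.scan (is j) = .inl (x j)) ∧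
        ∃ y ∈ f x, κ' = (κ.setCell i (.inl y)).setLabel l'
  | .test is f _ _ l' l'' =>
      ∃ x : ∀ j, X (is j), (∀ j, κ.scan (is j) = .inl (x j)) ∧
        ((letter zero ∈ f x ∧ κ' = κ.setLabel l') ∨ (letter one ∈ f x ∧ κ' = κ.setLabel l''))

/-- The successor relation; configurations with the final label have no successor. -/
def Step (κ κ' : M.Cfg) : Prop :=
  ∃ h : κ.label ≠ M.final, M.StmStep κ κ' (M.stm ⟨κ.label, h⟩)

/-- `(κ 0, κ 1, …)`, ending with `κ n` if `n` is finite, and infinite if `n = ⊤`, is a computation.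
The values of `κ` beyond `n` are irrelevant. -/
def IsComputation (n : ℕ∞) (κ : ℕ → M.Cfg) : Prop :=
  ∀ s : ℕ, (s : ℕ∞) < n → M.Step (κ s) (κ (s + 1))

/-- The computation is infinite or its last configuration has no successor. -/
def IsMaximal (n : ℕ∞) (κ : ℕ → M.Cfg) : Prop :=
  n = ⊤ ∨ ∃ s : ℕ, n = s ∧ ∀ κ', ¬ M.Step (κ s) κ'

/-- The label is final and cell `0` of Tape `0` contains the element `x₀` of `X 0`. -/
def AcceptsWith (κ : M.Cfg) (x₀ : X 0) : Prop :=
  κ.label = M.final ∧ κ.tape 0 0 = .inl x₀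

/-- The computation is finite and its last configuration is accepting. -/
def IsAccepting (n : ℕ∞) (κ : ℕ → M.Cfg) : Prop :=
  ∃ s : ℕ, n = s ∧ ∃ x₀, M.AcceptsWith (κ s) x₀

/-- The number of the `j`-th input tape: `0, …, k - 1` become `1, …, k`. -/
def inTape (j : Fin k) : Fin (L + 1) := (Fin.castLE M.k_le j).succ

/-- The initial configuration: the inputs are in the cells `0` of the input tapes, all other cells
are blank, all heads are at position `0`. -/
def initCfg (x : ∀ j, X (M.inTape j)) : M.Cfg where
  label := M.start
  tape := Fin.cases (motive := fun i => ℤ → X i ⊕ M.Γ) (fun _ => .inr M.blank)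
    (fun i z => if h : i.1 < k ∧ z = 0 then .inl (x ⟨i.1, h.1⟩) else .inr M.blank)
  head := fun _ => 0

/-- The multi-function computed by the machine. -/
def fn : MultiFun (∀ j, X (M.inTape j)) (X 0) := fun x =>
  {x₀ | (∀ n κ, M.IsComputation n κ → κ 0 = M.initCfg x → M.IsMaximal n κ → M.IsAccepting n κ) ∧
    ∃ (s : ℕ) (κ : ℕ → M.Cfg), M.IsComputation s κ ∧ κ 0 = M.initCfg x ∧ M.AcceptsWith (κ s) x₀}

end GTM

/-- The function used in a statement (if there is one) has the property `P`, for machines whose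
tape sets are given by the kinds `Y 0, …, Y L`. -/
def Stm.Uses {S : Type} {zero one : S} {Lab Γ : Type} {L : ℕ} {Y : Fin (L + 1) → Kind}
    (P : ∀ {n : ℕ} (Z : Fin n → Kind) (Z₀ : Kind), MultiFun (∀ j, Str S (Z j)) (Str S Z₀) → Prop) :
    Stm zero one Lab Γ (fun i => Str S (Y i)) → Prop
  | .assign i is f _ => P (fun j => Y (is j)) (Y i) f
  | .test is f _ _ _ _ => P (fun j => Y (is j)) .word f
  | _ => True

end GenTM

/-! Continuity. Single-valuedness and `zero ≠ one` make the successor of a configuration unique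
(`GTM.step_unique`), so a result comes from one finite run. Let configurations converge if labels
and heads agree eventually and every cell converges. Each statement respects this convergence
(`GTM.CfgTendsto.step`): a branch depends on a clopen property of one cell, a test on a value in a
discrete space, and an assignment is continuous by hypothesis. Near a point of the domain the other
runs therefore pass through the same labels, stop at the same time, and their configurations
converge; the result is one of the cells.

Computability. Infinite sequences are replaced by finite prefixes. A multi-function is
`Approximable` if a primitive recursive function of an effort bound and of prefixes of the arguments
never gives a wrong prefix of a value, and reaches every precision once effort and prefixes are
large enough. Three facts carry the proof. A Type-2 machine run for boundedly many steps on prefixes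
is such an approximation (`Type2Machine.fn_approximable`). The property passes from the statements
to the machine, because a run is finite and the required precision can be traced back through it
(`GTM.fn_approximable`). Conversely, an approximation yields a Type-2 machine: read one more symbol
per round, evaluate the approximation, and write the next symbol as soon as it is known
(`Approximable.exists_machine`).

The last fact needs a concrete machine. `exists_driver` builds it around the stack machine that
evaluates a `ToPartrec.Code`, with its four stacks on four work tapes. -/

open Filter Topology

namespace GenTM

/-! Continuity -/

namespace MultiFun

variable {A B : Type}

/-- Continuity on the domain, freed from the subtype: arguments outside the domain occur only off a
set of the filter, and are replaced by `a`. -/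
theorem IsContinuous.tendsto [TopologicalSpace A] [TopologicalSpace B] {f : MultiFun A B}
    (hf : f.IsContinuous) {ι : Type*} {F : Filter ι} {u : ι → A} {w : ι → B} {a : A} {b : B}
    (hu : Tendsto u F (𝓝 a)) (hw : ∀ᶠ y in F, w y ∈ f (u y)) (hb : b ∈ f a) :
    Tendsto w F (𝓝 b) := by
  classical
  obtain ⟨hs, g, hg, hgf⟩ := hf
  have ha : a ∈ f.dom := ⟨b, hb⟩
  let u' : ι → f.dom := fun y => if h : u y ∈ f.dom then ⟨u y, h⟩ else ⟨a, ha⟩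
  have hu' : ∀ᶠ y in F, (u' y : A) = u y := by
    filter_upwards [hw] with y hy
    have h : u y ∈ f.dom := ⟨_, hy⟩
    simp [u', h]
  have h1 : Tendsto u' F (𝓝 ⟨a, ha⟩) := by
    rw [tendsto_subtype_rng]
    exact hu.congr' (hu'.mono fun y hy => hy.symm)
  have h2 := (hg.tendsto ⟨a, ha⟩).comp h1
  rw [hs a (hgf ⟨a, ha⟩) hb] at h2
  refine h2.congr' ?_
  filter_upwards [hw, hu'] with y hy hy'
  have := hgf (u' y)
  rw [hy'] at this
  exact hs _ this hy

end MultiFun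

instance Str.discreteTopology_word (S : Type) : DiscreteTopology (Str S .word) := ⟨rfl⟩

theorem letter_injective {S : Type} : Function.Injective (letter : S → Str S .word) :=
  fun _ _ h => List.singleton_injective h

namespace Stm

theorem Uses.mono {S : Type} {zero one : S} {Lab Γ : Type} {L : ℕ} {Y : Fin (L + 1) → Kind}
    {P Q : ∀ {n : ℕ} (Z : Fin n → Kind) (Z₀ : Kind),
      MultiFun (∀ j, Str S (Z j)) (Str S Z₀) → Prop}
    (hPQ : ∀ {n : ℕ} (Z : Fin n → Kind) (Z₀ : Kind) (f), P Z Z₀ f → Q Z Z₀ f)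
    {q : Stm zero one Lab Γ (fun i => Str S (Y i))} (h : q.Uses P) : q.Uses Q := by
  cases q <;> first | exact hPQ _ _ _ h | trivial

end Stm

/-! ### Determinism of the generalized machine -/

namespace GTM

variable {S : Type} {zero one : S} {k L : ℕ} {X : Fin (L + 1) → Type} {Y : Fin (L + 1) → Kind}

theorem step_unique {N : GTM zero one k L (fun i => Str S (Y i))} (h01 : zero ≠ one)
    (hN : ∀ l, (N.stm l).Uses (fun _ _ f => f.SingleValued)) {κ κ₁ κ₂ : N.Cfg}
    (h₁ : N.Step κ κ₁) (h₂ : N.Step κ κ₂) : κ₁ = κ₂ := by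
  obtain ⟨hl, h₁⟩ := h₁
  obtain ⟨_, h₂⟩ := h₂
  have hu := hN ⟨κ.label, hl⟩
  generalize N.stm ⟨κ.label, hl⟩ = q at h₁ h₂ hu
  cases q with
  | right i l' => exact h₁.trans h₂.symm
  | left i l' => exact h₁.trans h₂.symm
  | write i a l' => exact h₁.trans h₂.symm
  | branch i a l' l'' =>
    rcases h₁ with ⟨a₁, rfl⟩ | ⟨a₁, rfl⟩ <;> rcases h₂ with ⟨a₂, rfl⟩ | ⟨a₂, rfl⟩
    · rfl
    · exact absurd a₁ a₂
    · exact absurd a₂ a₁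
    · rfl
  | assign i is f l' =>
    obtain ⟨x, hx, y, hy, rfl⟩ := h₁
    obtain ⟨x', hx', y', hy', rfl⟩ := h₂
    obtain rfl : x = x' := funext fun j => Sum.inl_injective ((hx j).symm.trans (hx' j))
    rw [hu x hy hy']
  | test is f hs hr l' l'' =>
    obtain ⟨x, hx, h₁⟩ := h₁
    obtain ⟨x', hx', h₂⟩ := h₂
    obtain rfl : x = x' := funext fun j => Sum.inl_injective ((hx j).symm.trans (hx' j))
    rcases h₁ with ⟨a₁, rfl⟩ | ⟨a₁, rfl⟩ <;> rcases h₂ with ⟨a₂, rfl⟩ | ⟨a₂, rfl⟩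
    · rfl
    · exact absurd (letter_injective (hs x a₁ a₂)) h01
    · exact absurd (letter_injective (hs x a₂ a₁)) h01
    · rfl

variable (N : GTM zero one k L X)

/-- `κ 0, …, κ s` is an accepting computation on the input `x` with the result `x₀`. -/
structure IsRun (x : ∀ j, X (N.inTape j)) (s : ℕ) (κ : ℕ → N.Cfg) (x₀ : X 0) : Prop where
  step : ∀ i < s, N.Step (κ i) (κ (i + 1))
  init : κ 0 = N.initCfg x
  accepts : N.AcceptsWith (κ s) x₀

variable {N}

theorem exists_isRun {x : ∀ j, X (N.inTape j)} {x₀ : X 0} (h : x₀ ∈ N.fn x) :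
    ∃ s κ, N.IsRun x s κ x₀ := by
  obtain ⟨_, s, κ, h₁, h₂, h₃⟩ := h
  exact ⟨s, κ, fun i hi => h₁ i (by exact_mod_cast hi), h₂, h₃⟩

/-- Two runs on one input agree as long as both last, and neither can continue past the final label;
so they have equal length and end in the same configuration. -/
theorem fn_singleValued {N : GTM zero one k L (fun i => Str S (Y i))} (h01 : zero ≠ one)
    (hN : ∀ l, (N.stm l).Uses (fun _ _ f => f.SingleValued)) : N.fn.SingleValued := by
  intro x a ha b hb
  obtain ⟨s, κ, h⟩ := exists_isRun ha
  obtain ⟨s', κ', h'⟩ := exists_isRun hb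
  have key : ∀ i, i ≤ s → i ≤ s' → κ i = κ' i := by
    intro i
    induction i with
    | zero => intro _ _; rw [h.init, h'.init]
    | succ i ih =>
      intro h₁ h₂
      have h₃ := h'.step i h₂
      rw [← ih (by omega) (by omega)] at h₃
      exact step_unique h01 hN (h.step i h₁) h₃
  have hs : s = s' := by
    rcases lt_trichotomy s s' with hlt | rfl | hlt
    · have e := key s le_rfl hlt.le
      exact absurd (e ▸ h.accepts.1) (h'.step s hlt).1
    · rfl
    · have e := key s' hlt.le le_rfl
      exact absurd (e ▸ h'.accepts.1) (h.step s' hlt).1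
  subst hs
  have e := h.accepts.2
  rw [key s le_rfl le_rfl, h'.accepts.2] at e
  exact (Sum.inl_injective e).symm

/-! ### Convergence of configurations along a filter -/

section Continuity

theorem tendsto_of_tendsto_inl {A B ι : Type*} [TopologicalSpace A] [TopologicalSpace B]
    {F : Filter ι} {v : ι → A} {a : A}
    (h : Tendsto (fun y => (Sum.inl (v y) : A ⊕ B)) F (𝓝 (Sum.inl a))) : Tendsto v F (𝓝 a) :=
  IsEmbedding.inl.tendsto_nhds_iff.2 h

variable {N : GTM zero one k L (fun i => Str S (Y i))} {ι : Type*} {F : Filter ι}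

local instance : TopologicalSpace N.Γ := ⊥
local instance : DiscreteTopology N.Γ := ⟨rfl⟩

variable (F) in
/-- The configurations `κ y` converge to `c`: labels and heads agree eventually, and the contents of
the cells converge. -/
structure CfgTendsto (κ : ι → N.Cfg) (c : N.Cfg) : Prop where
  label : ∀ᶠ y in F, (κ y).label = c.label
  head : ∀ᶠ y in F, (κ y).head = c.head
  tape : ∀ i z, Tendsto (fun y => (κ y).tape i z) F (𝓝 (c.tape i z))

namespace CfgTendsto

variable {κ κ' : ι → N.Cfg} {c : N.Cfg}

theorem congr' (h : CfgTendsto F κ c) (e : ∀ᶠ y in F, κ' y = κ y) : CfgTendsto F κ' c where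
  label := by filter_upwards [h.label, e] with y h₁ h₂; rw [h₂, h₁]
  head := by filter_upwards [h.head, e] with y h₁ h₂; rw [h₂, h₁]
  tape i z := (h.tape i z).congr' (e.mono fun y hy => by simp only [hy])

theorem setLabel (h : CfgTendsto F κ c) (l : N.Lab) :
    CfgTendsto F (fun y => (κ y).setLabel l) (c.setLabel l) where
  label := Eventually.of_forall fun _ => rfl
  head := h.head
  tape := h.tape

theorem setHead (h : CfgTendsto F κ c) (i : Fin (L + 1)) (d : ℤ) :
    CfgTendsto F (fun y => (κ y).setHead i ((κ y).head i + d)) (c.setHead i (c.head i + d)) where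
  label := h.label
  head := h.head.mono fun y hy => by simp [Cfg.setHead, hy]
  tape := h.tape

theorem setCell (h : CfgTendsto F κ c) (i : Fin (L + 1)) {v : ι → Str S (Y i) ⊕ N.Γ}
    {v₀ : Str S (Y i) ⊕ N.Γ} (hv : Tendsto v F (𝓝 v₀)) :
    CfgTendsto F (fun y => (κ y).setCell i (v y)) (c.setCell i v₀) where
  label := h.label
  head := h.head
  tape j z := by
    by_cases hj : j = i
    · subst hj
      by_cases hz : z = c.head j
      · subst hz
        simp only [Cfg.setCell, Function.update_self]
        exact hv.congr' (h.head.mono fun y hy => by simp [hy])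
      · simp only [Cfg.setCell, Function.update_self, Function.update_of_ne hz]
        exact (h.tape j z).congr' (h.head.mono fun y hy => 
          (Function.update_of_ne (by rwa [hy]) _ _).symm)
    · simpa [Cfg.setCell, Function.update_of_ne hj] using h.tape j z

theorem scan (h : CfgTendsto F κ c) (i : Fin (L + 1)) :
    Tendsto (fun y => (κ y).scan i) F (𝓝 (c.scan i)) :=
  (h.tape i (c.head i)).congr' (h.head.mono fun y hy => by simp [Cfg.scan, hy])

/-- `Γ` is discrete and is an open and closed summand of the cell space, so the set `{.inr a}` is
clopen. Hence the outcome of a branch is locally constant, both here and in the negative case. -/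
theorem scan_inr (h : CfgTendsto F κ c) {i : Fin (L + 1)} {a : N.Γ} (ha : c.scan i = .inr a) :
    ∀ᶠ y in F, (κ y).scan i = .inr a := by
  have := h.scan i
  rw [ha] at this
  refine this.eventually_mem (s := {.inr a}) (IsOpen.mem_nhds ?_ rfl)
  rw [← Set.image_singleton]
  exact isOpenMap_inr _ (isOpen_discrete _)

theorem scan_ne_inr (h : CfgTendsto F κ c) {i : Fin (L + 1)} {a : N.Γ} (ha : c.scan i ≠ .inr a) :
    ∀ᶠ y in F, (κ y).scan i ≠ .inr a := by
  refine (h.scan i).eventually_mem (s := {.inr a}ᶜ) (IsOpen.mem_nhds ?_ ha)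
  rw [isOpen_compl_iff, ← Set.image_singleton]
  exact IsClosedEmbedding.inr.isClosedMap _ (isClosed_discrete _)

theorem inputs (h : CfgTendsto F κ c) {n : ℕ} {is : Fin n → Fin (L + 1)}
    {x : ι → ∀ j, Str S (Y (is j))} {x' : ∀ j, Str S (Y (is j))}
    (hx : ∀ᶠ y in F, ∀ j, (κ y).scan (is j) = .inl (x y j))
    (hx' : ∀ j, c.scan (is j) = .inl (x' j)) : Tendsto x F (𝓝 x') := by
  rw [tendsto_pi_nhds]
  intro j
  have := h.scan (is j)
  rw [hx' j] at this
  exact tendsto_of_tendsto_inl (this.congr' (hx.mono fun y hy => hy j))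

theorem step [F.NeBot] (h01 : zero ≠ one)
    (hN : ∀ l, (N.stm l).Uses (fun _ _ f => f.IsContinuous))
    (h : CfgTendsto F κ c) {c' : N.Cfg} (hc : N.Step c c')
    (hκ : ∀ᶠ y in F, N.Step (κ y) (κ' y)) : CfgTendsto F κ' c' := by
  obtain ⟨hl, hc⟩ := hc
  have hκ : ∀ᶠ y in F, N.StmStep (κ y) (κ' y) (N.stm ⟨c.label, hl⟩) := by
    filter_upwards [hκ, h.label] with y ⟨h₁, h₂⟩ h₃
    simpa only [h₃] using h₂
  have hu := hN ⟨c.label, hl⟩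
  generalize N.stm ⟨c.label, hl⟩ = q at hc hκ hu
  cases q with
  | right i l' =>
    obtain rfl := hc
    exact ((h.setHead i 1).setLabel l').congr' hκ
  | left i l' =>
    obtain rfl := hc
    exact ((h.setHead i (-1)).setLabel l').congr' hκ
  | write i a l' =>
    obtain rfl := hc
    exact ((h.setCell i tendsto_const_nhds).setLabel l').congr' hκ
  | branch i a l' l'' =>
    rcases hc with ⟨ha, rfl⟩ | ⟨ha, rfl⟩
    · refine (h.setLabel l').congr' ?_
      filter_upwards [hκ, h.scan_inr ha] with y h₁ h₂
      exact (h₁.resolve_right fun h₃ => h₃.1 h₂).2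
    · refine (h.setLabel l'').congr' ?_
      filter_upwards [hκ, h.scan_ne_inr ha] with y h₁ h₂
      exact (h₁.resolve_left fun h₃ => h₂ h₃.1).2
  | assign i is f l' =>
    obtain ⟨x, hx, y, hy, rfl⟩ := hc
    -- The step relation supplies arguments and value for each `y` separately, and only eventually;
    -- they have to be made functions of `y` before their convergence can be used.
    obtain ⟨u, hu'⟩ := hκ.choice
    have hκ := hu'.mono fun _ h => h.2
    obtain ⟨w, hw⟩ := hκ.choice
    have hu' := h.inputs (hu'.mono fun _ h => h.1) hx
    have hw' : Tendsto w F (𝓝 y) := hu.tendsto hu' (hw.mono fun _ h => h.1) hy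
    exact ((h.setCell i ((continuous_inl.tendsto y).comp hw')).setLabel l').congr'
      (hw.mono fun _ h => h.2)
  | test is f hs hr l' l'' =>
    obtain ⟨x, hx, hc⟩ := hc
    obtain ⟨u, hu'⟩ := hκ.choice
    have hκ := hu'.mono fun _ h => h.2
    have hu' := h.inputs (hu'.mono fun _ h => h.1) hx
    classical
    have hw : ∃ w : ι → Str S .word, ∀ᶠ y in F, w y ∈ f (u y) ∧
        (w y = letter zero ∧ κ' y = (κ y).setLabel l' ∨
          w y = letter one ∧ κ' y = (κ y).setLabel l'') :=
      Eventually.choice (r := fun y b => b ∈ f (u y) ∧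
        (b = letter zero ∧ κ' y = (κ y).setLabel l' ∨
          b = letter one ∧ κ' y = (κ y).setLabel l'')) (hκ.mono fun y hy => by
        rcases hy with ⟨h₁, h₂⟩ | ⟨h₁, h₂⟩
        · exact ⟨_, h₁, .inl ⟨rfl, h₂⟩⟩
        · exact ⟨_, h₁, .inr ⟨rfl, h₂⟩⟩)
    obtain ⟨w, hw⟩ := hw
    -- Words are discrete, so convergence of the test results means that they are eventually equal,
    -- and the same branch is taken.
    have key : ∀ b, b ∈ f x → ∀ᶠ y in F, w y = b := by
      intro b hb
      have : Tendsto w F (𝓝 b) := hu.tendsto hu' (hw.mono fun _ h => h.1) hb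
      rwa [nhds_discrete, tendsto_pure] at this
    rcases hc with ⟨hb, rfl⟩ | ⟨hb, rfl⟩
    · refine (h.setLabel l').congr' ?_
      filter_upwards [hw, key _ hb] with y ⟨_, h₁⟩ h₂
      rcases h₁ with h₁ | h₁
      · exact h₁.2
      · exact absurd (letter_injective (h₂.symm.trans h₁.1)) h01
    · refine (h.setLabel l'').congr' ?_
      filter_upwards [hw, key _ hb] with y ⟨_, h₁⟩ h₂
      rcases h₁ with h₁ | h₁
      · exact absurd (letter_injective (h₁.1.symm.trans h₂)) h01
      · exact h₁.2

end CfgTendsto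

theorem initCfg_tendsto {u : ι → ∀ j, Str S (Y (N.inTape j))} {x : ∀ j, Str S (Y (N.inTape j))}
    (hu : Tendsto u F (𝓝 x)) :
    CfgTendsto F (fun y => N.initCfg (u y)) (N.initCfg x) where
  label := Eventually.of_forall fun _ => rfl
  head := Eventually.of_forall fun _ => rfl
  tape i z := by
    rw [tendsto_pi_nhds] at hu
    refine Fin.cases ?_ (fun i => ?_) i
    · exact tendsto_const_nhds
    · by_cases h : i.1 < k ∧ z = 0
      · simp only [initCfg, Fin.cases_succ, h, and_self, dite_true]
        exact (continuous_inl.tendsto _).comp (hu ⟨i.1, h.1⟩)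
      · simp only [initCfg, Fin.cases_succ, h, dite_false]
        exact tendsto_const_nhds

theorem fn_isContinuous (h01 : zero ≠ one)
    (hN : ∀ l, (N.stm l).Uses (fun _ _ f => f.IsContinuous)) : N.fn.IsContinuous := by
  refine ⟨fn_singleValued h01 fun l => (hN l).mono fun _ _ f hf => hf.1, ?_⟩
  have hdom : ∀ a : N.fn.dom, ∃ (b : Str S (Y 0)) (s : ℕ) (κ : ℕ → N.Cfg),
      b ∈ N.fn a ∧ N.IsRun a s κ b := fun a => by
    obtain ⟨b, hb⟩ := a.2
    obtain ⟨s, κ, h⟩ := exists_isRun hb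
    exact ⟨b, s, κ, hb, h⟩
  choose g s κ hg hrun using hdom
  refine ⟨g, continuous_iff_continuousAt.2 fun a => ?_, hg⟩
  -- That the nearby runs last long enough is part of the induction: the label at time `i < s a` is
  -- not final, and nearby labels coincide with it, so those runs cannot have stopped there.
  have key : ∀ i ≤ s a, (∀ᶠ y in 𝓝 a, i ≤ s y) ∧ CfgTendsto (𝓝 a) (fun y => κ y i) (κ a i) := by
    intro i
    induction i with
    | zero =>
      intro _
      refine ⟨Eventually.of_forall fun _ => Nat.zero_le _, ?_⟩
      simp only [(hrun _).init]
      exact initCfg_tendsto (continuous_subtype_val.tendsto a)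
    | succ i ih =>
      intro hi
      obtain ⟨h₁, h₂⟩ := ih (by omega)
      have hstep := (hrun a).step i hi
      have h₃ : ∀ᶠ y in 𝓝 a, i + 1 ≤ s y := by
        filter_upwards [h₁, h₂.label] with y h₃ h₄
        rcases h₃.eq_or_lt with e | hlt
        · have := (hrun y).accepts.1
          rw [← e, h₄] at this
          exact absurd this hstep.1
        · exact hlt
      exact ⟨h₃, h₂.step h01 hN hstep (h₃.mono fun y hy => (hrun y).step i hy)⟩
  obtain ⟨h₁, h₂⟩ := key (s a) le_rfl
  have h₃ : ∀ᶠ y in 𝓝 a, s y = s a := by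
    filter_upwards [h₁, h₂.label] with y h₃ h₄
    rcases h₃.eq_or_lt with e | hlt
    · exact e.symm
    · exact absurd (h₄.trans (hrun a).accepts.1) ((hrun y).step _ hlt).1
  have h₄ := h₂.tape 0 0
  rw [(hrun a).accepts.2] at h₄
  refine tendsto_of_tendsto_inl (h₄.congr' ?_)
  filter_upwards [h₃] with y hy
  rw [← hy, (hrun y).accepts.2]

end Continuity

end GTM

/-! A Type-2 machine that is driven by a computable function -/

namespace Driver

open Turing Turing.PartrecToTM2 StateTransition

theorem listBlank_cons_default {G : Type} [Inhabited G] :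
    ListBlank.cons (default : G) (ListBlank.mk []) = ListBlank.mk [] := by
  refine ListBlank.ext fun i => ?_
  cases i <;> simp [ListBlank.cons_mk, ListBlank.nth_mk]

/-- A stack as the inscription of a work tape, with the head on the top of the stack. -/
def stackTape (l : List Γ') : Tape (Option Γ') :=
  Tape.mk' (ListBlank.mk []) (ListBlank.mk (l.map some))

@[simp]
theorem stackTape_head (l : List Γ') : (stackTape l).head = l.head? := by
  cases l <;> rfl

theorem stackTape_write_head (l : List Γ') : (stackTape l).write l.head? = stackTape l := by
  conv_lhs => rw [← stackTape_head]
  exact Tape.write_self _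

/-- The popped cell is blanked before the head leaves it, so everything to the left of the head
stays blank. -/
theorem stackTape_pop (l : List Γ') :
    ((stackTape l).write none).move .right = stackTape l.tail := by
  rw [stackTape, Tape.write_mk', Tape.move_right_mk', ListBlank.head_cons, ListBlank.tail_cons,
    ListBlank.tail_mk, ← List.map_tail]
  exact congrArg (Tape.mk' · _) (listBlank_cons_default (G := Option Γ'))

theorem stackTape_push (l : List Γ') (x : Γ') :
    ((stackTape l).move .left).write (some x) = stackTape (x :: l) := by
  rw [stackTape, Tape.move_left_mk', Tape.write_mk', ListBlank.tail_cons, ListBlank.tail_mk,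
    ListBlank.cons_mk]
  rfl

/-- Statements of the stack machines that evaluate codes. -/
abbrev Stmt : Type := TM2.Stmt (fun _ : K' => Γ') Λ' (Option Γ')

/-- States of the driver: execution of a statement (with the contents of the variable, and a flag
for the second half of a push), decoding of the result, and reading of the input. -/
inductive State
  | exec (q : Stmt) (v : Option Γ') (ready : Bool)
  | decode (acc : List Γ')
  | read (first : Bool)

/-- Push a word to the main stack. -/
def pushes : List Γ' → Stmt → Stmt
  | [], q => q
  | x :: w, q => pushes w (.push .main (fun _ => x) q)

theorem stepAux_pushes (w : List Γ') (q : Stmt) (v : Option Γ') (l : List Γ') :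
    TM2.stepAux (pushes w q) v (K'.elim l [] [] []) =
      TM2.stepAux q v (K'.elim (w ++ l) [] [] []) := by
  induction w generalizing q with
  | nil => rfl
  | cons x w ih => rw [pushes, ih]; simp

/-- The stacks of the evaluator are on the four work tapes of the driver. -/
def tapeEquiv : Fin 4 ≃ K' where
  toFun := ![.main, .rev, .aux, .stack]
  invFun
    | .main => 0
    | .rev => 1
    | .aux => 2
    | .stack => 3
  left_inv i := by fin_cases i <;> rfl
  right_inv r := by cases r <;> rfl

variable {S : Type} {n : ℕ}

/-- The action that only changes the state. -/
def idle (heads : Fin 4 → Option Γ') (q : State) : Action S State (Option Γ') n 4 where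
  next := q
  inMove _ := none
  write := heads
  workMove _ := none
  out := none

/-- The action that writes on one work tape and moves its head. -/
def onTape (heads : Fin 4 → Option Γ') (r : K') (x : Option Γ') (d : Option Dir) (q : State) :
    Action S State (Option Γ') n 4 where
  next := q
  inMove _ := none
  write := Function.update heads (tapeEquiv.symm r) x
  workMove := Function.update (fun _ => none) (tapeEquiv.symm r) d
  out := none

/-! ### The evaluator of a code as the control of a Type-2 machine -/

section Machine

variable (c : ToPartrec.Code) (enc : (Fin n → Option S) → ℕ) (D : List Γ' → Option (Option S))
  (B : ℕ)

/-- Push the code of the symbols that are read (and in the beginning the number `0`), then evaluate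
the code. -/
def entry (first : Bool) (a : Fin n → Option S) : Stmt :=
  pushes (trNat (enc a) ++ Γ'.cons :: if first then [Γ'.cons] else [])
    (.goto fun _ => trNormal c .halt)

/-- The transition function of the driver. -/
def trans : State → (Fin n → Option S) → (Fin 4 → Option Γ') →
    Option (Action S State (Option Γ') n 4)
  | .exec (.push r f q) v false, _, heads =>
      some (onTape heads r (heads (tapeEquiv.symm r)) (some .left) (.exec (.push r f q) v true))
  | .exec (.push r f q) v true, _, heads =>
      some (onTape heads r (some (f v)) none (.exec q v false))
  | .exec (.peek r f q) v _, _, heads =>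
      some (idle heads (.exec q (f v (heads (tapeEquiv.symm r))) false))
  | .exec (.pop r f q) v _, _, heads =>
      some (onTape heads r none (some .right) (.exec q (f v (heads (tapeEquiv.symm r))) false))
  | .exec (.load f q) v _, _, heads => some (idle heads (.exec q (f v) false))
  | .exec (.branch f q₁ q₂) v _, _, heads =>
      some (idle heads (.exec (cond (f v) q₁ q₂) v false))
  | .exec (.goto f) v _, _, heads => some (idle heads (.exec (tr (f v)) v false))
  | .exec .halt _ _, _, heads => some (idle heads (.decode []))
  | .decode acc, _, heads =>
      match heads (tapeEquiv.symm .main) with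
      | none => none
      | some .cons => (D acc).map fun o =>
          { (onTape heads .main none (some .right) (.read false) : Action S State _ n 4) with
            inMove := fun _ => some .right
            out := o }
      | some x =>
          if acc.length < B then
            some (onTape heads .main none (some .right) (.decode (acc ++ [x])))
          else none
  | .read first, a, heads => some (idle heads (.exec (entry c enc first a) none false))

/-- The statements that the driver executes. -/
def stmts : Set Stmt :=
  {q | (∃ l ∈ codeSupp c .halt, q ∈ TM2.stmts₁ (tr l)) ∨
    ∃ first a, q ∈ TM2.stmts₁ (entry c enc first a)}

/-- The states that the driver uses. -/
def states : Set State :=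
  {s | match s with
    | .exec q _ _ => q ∈ stmts c enc
    | .decode acc => acc.length ≤ B
    | .read _ => True}

variable {c enc D B}

theorem trNormal_mem : trNormal c .halt ∈ codeSupp c .halt := (tr_supports c .halt).1

theorem tr_mem {l : Λ'} (h : l ∈ codeSupp c .halt) : tr l ∈ stmts c enc :=
  .inl ⟨l, h, TM2.stmts₁_self⟩

theorem stmts_of_mem {q q' : Stmt} (h : q ∈ stmts c enc) (h' : q' ∈ TM2.stmts₁ q) :
    q' ∈ stmts c enc := by
  rcases h with ⟨l, hl, h⟩ | ⟨b, a, h⟩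
  · exact .inl ⟨l, hl, TM2.stmts₁_trans h h'⟩
  · exact .inr ⟨b, a, TM2.stmts₁_trans h h'⟩

/-- This makes the control finite although `Stmt` is infinite: a fixed code only reaches labels in
`codeSupp`, each statement has finitely many substatements, and finiteness of `S` bounds the number
of entry statements. -/
theorem stmts_finite [Finite S] : (stmts c enc).Finite := by
  refine .subset (.union (.biUnion (codeSupp c .halt).finite_toSet
    fun l _ => (TM2.stmts₁ (tr l)).finite_toSet)
    (Set.finite_iUnion fun b => Set.finite_iUnion fun a =>
      (TM2.stmts₁ (entry c enc b a)).finite_toSet)) ?_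
  rintro q (⟨l, hl, h⟩ | ⟨b, a, h⟩)
  · exact .inl (Set.mem_biUnion hl h)
  · exact .inr (Set.mem_iUnion₂.2 ⟨b, a, h⟩)

theorem states_finite [Finite S] : (states c enc B).Finite := by
  refine .subset (.union (.union
    (((stmts_finite (c := c) (enc := enc)).prod (Set.finite_univ (α := Option Γ' × Bool))).image
      fun x => State.exec x.1 x.2.1 x.2.2)
    ((List.finite_length_le Γ' B).image State.decode)) (Set.finite_range State.read)) ?_
  rintro (⟨q, v, b⟩ | acc | b) h
  · exact .inl (.inl ⟨(q, v, b), ⟨h, trivial⟩, rfl⟩)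
  · exact .inl (.inr ⟨acc, h, rfl⟩)
  · exact .inr ⟨b, rfl⟩

variable (c enc B) in
open Classical in
/-- Every state as a state of the driver, if possible. -/
noncomputable def toState (s : State) : states c enc B :=
  if h : s ∈ states c enc B then ⟨s, h⟩ else ⟨.read true, trivial⟩

theorem toState_val {s : State} (h : s ∈ states c enc B) : (toState c enc B s).1 = s := by
  rw [toState, dif_pos h]

variable (c enc D B) in
/-- The driver. -/
noncomputable def machine [Finite S] : Type2Machine S n where
  State := states c enc B
  finState := states_finite.to_subtype
  Work := Option Γ'
  blank := inferInstance
  numWork := 4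
  start := toState c enc B (.read true)
  δ s a heads := (trans c enc D B s.1 a heads).map fun act =>
    { act with next := toState c enc B act.next }

theorem idle_tapes (st : K' → List Γ') (s : State) :
    (fun r : Fin 4 => Type2Machine.moveTape
      ((idle (S := S) (n := n) (fun r => (st (tapeEquiv r)).head?) s).workMove r)
      ((stackTape (st (tapeEquiv r))).write
        ((idle (S := S) (n := n) (fun r => (st (tapeEquiv r)).head?) s).write r))) =
    fun r => stackTape (st (tapeEquiv r)) := by
  funext r
  simp only [idle, Type2Machine.moveTape]
  rw [← stackTape_head, Tape.write_self]

theorem onTape_tapes (w : Fin 4 → Tape (Option Γ')) (k : K') (x : Option Γ') (d : Option Dir)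
    (s : State) :
    (fun r : Fin 4 => Type2Machine.moveTape
      ((onTape (S := S) (n := n) (fun r => (w r).head) k x d s).workMove r)
      ((w r).write ((onTape (S := S) (n := n) (fun r => (w r).head) k x d s).write r))) =
    Function.update w (tapeEquiv.symm k)
      (Type2Machine.moveTape d ((w (tapeEquiv.symm k)).write x)) := by
  funext r
  by_cases h : r = tapeEquiv.symm k
  · subst h; simp [onTape]
  · simp [onTape, Function.update_of_ne h, Type2Machine.moveTape, Tape.write_self]

theorem update_stackTape (st : K' → List Γ') (k : K') (l : List Γ') :
    Function.update (fun r => stackTape (st (tapeEquiv r))) (tapeEquiv.symm k) (stackTape l) =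
      fun r => stackTape (Function.update st k l (tapeEquiv r)) := by
  funext r
  by_cases h : r = tapeEquiv.symm k
  · subst h; simp
  · have : tapeEquiv r ≠ k := fun e => h (by simp [← e])
    simp [Function.update_of_ne h, Function.update_of_ne this]

variable [Finite S] {Y : Fin n → Kind} (p : ∀ j, Str S (Y j))

variable (c enc D B) in
/-- A configuration of the driver: state, positions of the input heads, work tapes, output. -/
noncomputable def mkCfg (s : State) (h : Fin n → ℤ) (w : Fin 4 → Tape (Option Γ')) (o : List S) :
    (machine c enc D B).Cfg where
  state := toState c enc B s
  inHead := h
  work := w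
  out := o

variable (c enc D B) in
/-- A configuration of the driver: state, position of all input heads, stacks, output. -/
noncomputable def cfg (s : State) (t : ℕ) (st : K' → List Γ') (o : List S) :
    (machine c enc D B).Cfg :=
  mkCfg c enc D B s (fun _ => t) (fun r => stackTape (st (tapeEquiv r))) o

theorem step_eq {s : State} (hs : s ∈ states c enc B) {t : ℕ} {w : Fin 4 → Tape (Option Γ')}
    {o : List S} {act : Action S State (Option Γ') n 4}
    (h : trans c enc D B s (fun j => (p j).symbolAt t) (fun r => (w r).head) = some act) :
    (machine c enc D B).step p (mkCfg c enc D B s (fun _ => t) w o) =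
      some (mkCfg c enc D B act.next (fun j => t + Type2Machine.shift (act.inMove j))
        (fun r => Type2Machine.moveTape (act.workMove r) ((w r).write (act.write r)))
        (o ++ act.out.toList)) := by
  have h' : (machine c enc D B).δ (toState c enc B s) (fun j => (p j).symbolAt t)
      (fun r => (w r).head) = some { act with next := toState c enc B act.next } := by
    simp only [machine, toState_val hs, h, Option.map_some]
  rw [Type2Machine.step, mkCfg, h']
  rfl

theorem step_eq_none {s : State} (hs : s ∈ states c enc B) {t : ℕ} {w : Fin 4 → Tape (Option Γ')}
    {o : List S}
    (h : trans c enc D B s (fun j => (p j).symbolAt t) (fun r => (w r).head) = none) :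
    (machine c enc D B).step p (mkCfg c enc D B s (fun _ => t) w o) = none := by
  have h' : (machine c enc D B).δ (toState c enc B s) (fun j => (p j).symbolAt t)
      (fun r => (w r).head) = none := by
    simp only [machine, toState_val hs, h, Option.map_none]
  rw [Type2Machine.step, mkCfg, h']
  rfl

theorem step_idle {s s' : State} (hs : s ∈ states c enc B) {t : ℕ} {st : K' → List Γ'}
    {o : List S}
    (h : trans c enc D B s (fun j => (p j).symbolAt t) (fun r => (st (tapeEquiv r)).head?) =
      some (idle (fun r => (st (tapeEquiv r)).head?) s')) :
    (machine c enc D B).step p (cfg c enc D B s t st o) = some (cfg c enc D B s' t st o) := by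
  have := step_eq p hs (t := t) (o := o) (w := fun r => stackTape (st (tapeEquiv r)))
    (by simpa only [stackTape_head] using h)
  rw [cfg, this, idle_tapes]
  simp [idle, cfg, Type2Machine.shift]

theorem step_pop {s s' : State} (hs : s ∈ states c enc B) {t : ℕ} {st : K' → List Γ'}
    {o : List S} {k : K'}
    (h : trans c enc D B s (fun j => (p j).symbolAt t) (fun r => (st (tapeEquiv r)).head?) =
      some (onTape (fun r => (st (tapeEquiv r)).head?) k none (some .right) s')) :
    (machine c enc D B).step p (cfg c enc D B s t st o) =
      some (cfg c enc D B s' t (Function.update st k (st k).tail) o) := by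
  have := step_eq p hs (t := t) (o := o) (w := fun r => stackTape (st (tapeEquiv r)))
    (by simpa only [stackTape_head] using h)
  have e := onTape_tapes (S := S) (n := n) (fun r => stackTape (st (tapeEquiv r))) k none
    (some .right) s'
  simp only [stackTape_head] at e
  rw [cfg, this, e]
  simp only [Type2Machine.moveTape, Equiv.apply_symm_apply, stackTape_pop, update_stackTape]
  simp [onTape, cfg, Type2Machine.shift]

/-- A step writes before it moves, whereas a push moves left before it writes. So a push takes two
steps, the first of which rewrites the scanned symbol. The tape in between is not a `stackTape`,
which is why `mkCfg` admits arbitrary tapes. -/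
theorem reaches_push {k : K'} {f : Option Γ' → Γ'} {q : Stmt} {v : Option Γ'}
    (hq : .push k f q ∈ stmts c enc) (t : ℕ) (st : K' → List Γ') (o : List S) :
    Reaches ((machine c enc D B).step p) (cfg c enc D B (.exec (.push k f q) v false) t st o)
      (cfg c enc D B (.exec q v false) t (Function.update st k (f v :: st k)) o) := by
  have h₁ := step_eq p (s := .exec (.push k f q) v false) (D := D) (B := B) hq (t := t) (o := o)
    (w := fun r => stackTape (st (tapeEquiv r))) (act := _) rfl
  rw [onTape_tapes] at h₁
  set w := Function.update (fun r => stackTape (st (tapeEquiv r))) (tapeEquiv.symm k)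
    ((stackTape (st k)).move .left) with hw
  have h₂ := step_eq p (s := .exec (.push k f q) v true) (D := D) (B := B) hq (t := t) (o := o)
    (w := w) (act := _) rfl
  rw [onTape_tapes] at h₂
  refine .head (b := mkCfg c enc D B (.exec (.push k f q) v true) (fun _ => t) w o) ?_
    (.single ?_)
  · rw [Option.mem_def, cfg, h₁]
    simp [onTape, Type2Machine.shift, Type2Machine.moveTape, w, stackTape_write_head]
  · rw [Option.mem_def, h₂]
    simp only [w, Type2Machine.moveTape, Function.update_self, stackTape_push,
      Function.update_idem, update_stackTape]
    simp [onTape, cfg, Type2Machine.shift]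

variable (c enc D B) in
/-- A configuration of the evaluator as a configuration of the driver. -/
noncomputable def embed (t : ℕ) (o : List S)
    (C : TM2.Cfg (fun _ : K' => Γ') Λ' (Option Γ')) : (machine c enc D B).Cfg :=
  cfg c enc D B (C.l.elim (.decode []) fun l => .exec (tr l) C.var false) t C.stk o

theorem reaches_stepAux (t : ℕ) (o : List S) {q : Stmt} (hq : q ∈ stmts c enc) (v : Option Γ')
    (st : K' → List Γ') :
    Reaches ((machine c enc D B).step p) (cfg c enc D B (.exec q v false) t st o)
      (embed c enc D B t o (TM2.stepAux q v st)) := by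
  induction q generalizing v st with
  | push k f q ih =>
    exact (reaches_push p hq t st o).trans (ih (stmts_of_mem hq
      (by simp [TM2.stmts₁, TM2.stmts₁_self])) _ _)
  | peek k f q ih =>
    refine .head (step_idle p hq (s' := .exec q (f v (st k).head?) false) ?_)
      (ih (stmts_of_mem hq (by simp [TM2.stmts₁, TM2.stmts₁_self])) _ _)
    simp [trans]
  | pop k f q ih =>
    refine .head (step_pop p hq (k := k) (s' := .exec q (f v (st k).head?) false) ?_)
      (ih (stmts_of_mem hq (by simp [TM2.stmts₁, TM2.stmts₁_self])) _ _)
    simp [trans]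
  | load f q ih =>
    exact .head (step_idle p hq rfl)
      (ih (stmts_of_mem hq (by simp [TM2.stmts₁, TM2.stmts₁_self])) _ _)
  | branch f q₁ q₂ ih₁ ih₂ =>
    refine .head (step_idle p hq rfl) ?_
    rw [TM2.stepAux]
    cases f v
    · exact ih₂ (stmts_of_mem hq (by simp [TM2.stmts₁, TM2.stmts₁_self])) _ _
    · exact ih₁ (stmts_of_mem hq (by simp [TM2.stmts₁, TM2.stmts₁_self])) _ _
  | goto f => exact .single (step_idle p hq rfl)
  | halt => exact .single (step_idle p hq rfl)

/-- The label stays in the finite support throughout, so `toState` never falls back on its default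
value. -/
theorem reaches_embed (t : ℕ) (o : List S) {C C' : TM2.Cfg (fun _ : K' => Γ') Λ' (Option Γ')}
    (hC : C.l ∈ Finset.insertNone (codeSupp c .halt)) (h : Reaches (TM2.step tr) C C') :
    Reaches ((machine c enc D B).step p) (embed c enc D B t o C) (embed c enc D B t o C') := by
  induction h using Relation.ReflTransGen.head_induction_on with
  | refl => exact .refl
  | @head C C₁ h₁ _ ih =>
    -- Support refers to the default label as the start label, so the `Inhabited` instance is given
    -- by hand.
    refine .trans ?_ (ih (@TM2.step_supports _ _ _ _ ⟨trNormal c .halt⟩ _ tr _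
      (tr_supports c .halt) _ _ h₁ hC))
    obtain ⟨_ | l, v, st⟩ := C
    · exact absurd h₁ (by simp [TM2.step])
    · have h₁ : some (TM2.stepAux (tr l) v st) = some C₁ := h₁
      obtain rfl := Option.some_inj.1 h₁
      exact reaches_stepAux p t o (tr_mem (Finset.some_mem_insertNone.1 hC)) v st

/-- The digits of the first result move from the stack into the finite control, where `B` bounds the
number of them that can be stored. -/
theorem reaches_decode (acc w : List Γ') (hw : ∀ x ∈ w, natEnd x = false)
    (hB : (acc ++ w).length ≤ B) (t : ℕ) (l : List Γ') (o : List S) :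
    Reaches ((machine c enc D B).step p)
      (cfg c enc D B (.decode acc) t (K'.elim (w ++ l) [] [] []) o)
      (cfg c enc D B (.decode (acc ++ w)) t (K'.elim l [] [] []) o) := by
  induction w generalizing acc with
  | nil => rw [List.append_nil]; exact .refl
  | cons x w ih =>
    have hlt : acc.length < B := by
      simp only [List.length_append, List.length_cons] at hB; omega
    refine .head (b := cfg c enc D B (.decode (acc ++ [x])) t (K'.elim (w ++ l) [] [] []) o) ?_ ?_
    · rw [Option.mem_def, step_pop p (k := .main) (s' := .decode (acc ++ [x]))]
      · simp
      · exact hlt.le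
      · have hx := hw x (by simp)
        cases x <;> simp_all [trans]
    · have := ih (acc ++ [x]) (fun y hy => hw y (by simp [hy])) (by simpa using hB)
      simp only [List.append_assoc, List.singleton_append] at this
      exact this

/-- One round up to its decision: the code of the symbols read is put on top of the code of the
memory, and evaluation replaces both by the code of the action and that of the new memory. In the
first round the stack is empty; the extra separator in `entry` turns it into the list `[0]`, whence
`hb`. -/
theorem reaches_eval {f : (Fin n → Option S) → ℕ → ℕ × ℕ}
    (hc : ∀ a m, c.eval [enc a, m] = pure [(f a m).1, (f a m).2])
    (hB : ∀ a m, (trNat (f a m).1).length ≤ B) {b : Bool} {m : ℕ} (hb : b → m = 0) (t : ℕ)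
    (o : List S) :
    Reaches ((machine c enc D B).step p)
      (cfg c enc D B (.read b) t (K'.elim (if b then [] else trList [m]) [] [] []) o)
      (cfg c enc D B (.decode (trNat (f (fun j => (p j).symbolAt t) m).1)) t
        (K'.elim (.cons :: trList [(f (fun j => (p j).symbolAt t) m).2]) [] [] []) o) := by
  set a : Fin n → Option S := fun j => (p j).symbolAt t with ha
  refine .head (step_idle p (s := .read b) (s' := .exec (entry c enc b a) none false) trivial rfl) ?_
  refine (reaches_stepAux p t o (.inr ⟨b, a, TM2.stmts₁_self⟩) none _).trans ?_
  have h₁ : TM2.stepAux (entry c enc b a) none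
      (K'.elim (if b then [] else trList [m]) [] [] []) = init c [enc a, m] := by
    rw [entry, stepAux_pushes]
    cases b
    · simp [init, trList]
    · simp [init, trList, hb rfl]
  have h₂ : halt [(f a m).1, (f a m).2] ∈ eval (TM2.step tr) (init c [enc a, m]) := by
    rw [PartrecToTM2.tr_eval, hc]
    exact (Part.mem_map_iff _).2 ⟨_, Part.mem_some _, rfl⟩
  rw [h₁]
  refine (reaches_embed p t o (C' := halt [(f a m).1, (f a m).2])
    (Finset.some_mem_insertNone.2 trNormal_mem) (mem_eval.1 h₂).1).trans ?_
  have := reaches_decode (c := c) (enc := enc) (D := D) p [] (trNat (f a m).1) (trNat_natEnd _)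
    (by simpa using hB a m) t (.cons :: trList [(f a m).2]) o
  rw [List.nil_append] at this
  exact this

theorem step_decode_none {acc : List Γ'} (hacc : acc.length ≤ B) (hD : D acc = none) (t : ℕ)
    (l : List Γ') (o : List S) :
    (machine c enc D B).step p (cfg c enc D B (.decode acc) t (K'.elim (.cons :: l) [] [] []) o) =
      none := by
  refine step_eq_none p hacc ?_
  simp [trans, hD]

theorem step_decode_some {acc : List Γ'} (hacc : acc.length ≤ B) {x : Option S}
    (hD : D acc = some x) (t : ℕ) (l : List Γ') (o : List S) :
    (machine c enc D B).step p (cfg c enc D B (.decode acc) t (K'.elim (.cons :: l) [] [] []) o) =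
      some (cfg c enc D B (.read false) (t + 1) (K'.elim l [] [] []) (o ++ x.toList)) := by
  have e := onTape_tapes (S := S) (n := n)
    (fun r => stackTape (K'.elim (.cons :: l) [] [] [] (tapeEquiv r))) .main none
    (some .right) (.read false)
  rw [cfg, step_eq p (s := .decode acc) hacc (w := fun r => stackTape _) (act :=
    { (onTape (fun r => (stackTape (K'.elim (.cons :: l) [] [] [] (tapeEquiv r))).head)
        .main none (some .right) (.read false) : Action S State _ n 4) with
      inMove := fun _ => some .right
      out := x }) (by simp [trans, hD]), e]
  simp only [Type2Machine.moveTape, Equiv.apply_symm_apply, stackTape_pop, update_stackTape]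
  simp [onTape, cfg, Type2Machine.shift]

end Machine
theorem trPosNum_injective : Function.Injective trPosNum := by
  intro a b h
  induction a generalizing b with
  | one =>
    cases b with
    | one => rfl
    | bit1 b => cases b <;> simp [trPosNum] at h
    | bit0 b => simp [trPosNum] at h
  | bit1 a ih =>
    cases b with
    | one => cases a <;> simp [trPosNum] at h
    | bit1 b => rw [ih (by simpa [trPosNum] using h)]
    | bit0 b => simp [trPosNum] at h
  | bit0 a ih =>
    cases b with
    | one => simp [trPosNum] at h
    | bit1 b => simp [trPosNum] at h
    | bit0 b => rw [ih (by simpa [trPosNum] using h)]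

/-- Allows the action to be recovered from the digits of its code. -/
theorem trNat_injective : Function.Injective trNat := by
  intro a b h
  have key : ∀ x y : Num, trNum x = trNum y → x = y := by
    rintro (_ | x) (_ | y) h
    · rfl
    · cases y <;> simp [trNum, trPosNum] at h
    · cases x <;> simp [trNum, trPosNum] at h
    · exact congrArg _ (trPosNum_injective h)
  exact_mod_cast key a b h

theorem exists_code₂ {f : ℕ → ℕ → ℕ} (hf : Computable₂ f) :
    ∃ c : ToPartrec.Code, ∀ x m, c.eval [x, m] = pure [f x m] := by
  obtain ⟨c, hc⟩ := ToPartrec.Code.exists_code (Nat.Partrec'.part_iff₂.2 hf.partrec₂)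
  refine ⟨c, fun x m => ?_⟩
  refine (hc ⟨[x, m], rfl⟩).trans ?_
  exact Part.map_some _ _

end Driver

namespace Type2Machine

variable {S : Type} {n : ℕ} {M : Type2Machine S n} {Y : Fin n → Kind} {p : ∀ j, Str S (Y j)}

theorem run_succ {s : ℕ} {c : M.Cfg} (h : M.run p s = some c) : M.run p (s + 1) = M.step p c := by
  rw [run, h, Option.bind_some]

theorem run_of_reaches {c c' : M.Cfg} (hc : StateTransition.Reaches (M.step p) c c') {s : ℕ}
    (h : M.run p s = some c) : ∃ s', s ≤ s' ∧ M.run p s' = some c' := by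
  induction hc with
  | refl => exact ⟨s, le_rfl, h⟩
  | tail _ h₁ ih =>
    obtain ⟨s', hs, h'⟩ := ih
    exact ⟨s' + 1, by omega, (run_succ h').trans h₁⟩

end Type2Machine

open Driver Turing Turing.PartrecToTM2 in
/-- For computable functions `act` and `next` there is a Type-2 machine that, with the contents `s₀`
of its memory at the beginning, at time `t = 0, 1, …` reads the symbols at position `t` on the input
tapes, and halts or possibly writes a symbol, as given by `act`, and updates its memory by `next`. -/
theorem exists_driver {S : Type} [Finite S] [Primcodable S] {n : ℕ} {σ : Type} [Primcodable σ]
    (s₀ : σ) {act : (Fin n → Option S) → σ → Option (Option S)}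
    {next : (Fin n → Option S) → σ → σ} (hact : Computable₂ act) (hnext : Computable₂ next) :
    ∃ M : Type2Machine S n, ∀ {Y : Fin n → Kind} (p : ∀ j, Str S (Y j)) (mem : ℕ → σ)
      (out : ℕ → List S), mem 0 = s₀ → out 0 = [] → ∀ T,
      (∀ t < T, mem (t + 1) = next (fun j => (p j).symbolAt t) (mem t) ∧
        ∃ x, act (fun j => (p j).symbolAt t) (mem t) = some x ∧ out (t + 1) = out t ++ x.toList) →
      ∃ s c, T ≤ s ∧ M.run p s = some c ∧ c.out = out T ∧
        (act (fun j => (p j).symbolAt T) (mem T) = none →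
          ∃ s c, M.run p s = some c ∧ M.step p c = none ∧ c.out = out T) := by
  -- The coding of tuples is fixed as the one underlying the `Primcodable` instance, about which the
  -- computability lemmas speak.
  let dec : ℕ → Option (Fin n → Option S) := @Encodable.decode _ Primcodable.toEncodable
  let enc : (Fin n → Option S) → ℕ := @Encodable.encode _ Primcodable.toEncodable
  have hdec : Computable dec := Computable.decode
  have hencdec : ∀ a, dec (enc a) = some a := fun a => @Encodable.encodek _ Primcodable.toEncodable a
  -- A memory `x` is coded as `some x`; the code `0` of `none` then stands for `s₀`, so the driver
  -- may start with `0`.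
  let val : ℕ → σ := fun m => ((Encodable.decode m : Option (Option σ)).getD none).getD s₀
  have hval : Computable val :=
    (Computable.option_getD (Computable.option_getD Computable.decode (Computable.const none))
      (Computable.const s₀))
  let fa : ℕ → ℕ → ℕ := fun x m =>
    ((dec x).map fun a => Encodable.encode (act a (val m))).getD 0
  let fm : ℕ → ℕ → ℕ := fun x m =>
    ((dec x).map fun a => Encodable.encode (some (next a (val m)))).getD 0
  have hfa : Computable₂ fa := by
    refine Computable.option_getD (Computable.option_map (hdec.comp Computable.fst)
      (Computable.encode.comp (hact.comp Computable.snd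
        (hval.comp (Computable.snd.comp Computable.fst)))).to₂) (Computable.const 0)
  have hfm : Computable₂ fm := by
    refine Computable.option_getD (Computable.option_map (hdec.comp Computable.fst)
      (Computable.encode.comp (Computable.option_some.comp (hnext.comp Computable.snd
        (hval.comp (Computable.snd.comp Computable.fst))))).to₂) (Computable.const 0)
  obtain ⟨ca, hca⟩ := exists_code₂ hfa
  obtain ⟨cm, hcm⟩ := exists_code₂ hfm
  let code : Option (Option S) → List Γ' := fun x => trNat (Encodable.encode x)
  have hcode : Function.Injective code := trNat_injective.comp Encodable.encode_injective
  obtain ⟨B, hB⟩ := (Set.finite_range fun x => (code x).length).bddAbove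
  replace hB : ∀ x, (code x).length ≤ B := fun x => hB ⟨x, rfl⟩
  -- `D` belongs to the finite control, so any left inverse will do; it need not be computable.
  let D : List Γ' → Option (Option S) := Function.invFun code
  have hD : ∀ x, D (code x) = x := Function.leftInverse_invFun hcode
  let f : (Fin n → Option S) → ℕ → ℕ × ℕ := fun a m =>
    (Encodable.encode (act a (val m)), Encodable.encode (some (next a (val m))))
  have hc : ∀ (a : Fin n → Option S) m, (ToPartrec.Code.cons ca cm).eval [enc a, m] =
      pure [(f a m).1, (f a m).2] := by
    intro a m
    simp [hca, hcm, fa, fm, f, hencdec]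
  refine ⟨machine (.cons ca cm) enc D B, fun p mem out hmem hout T hT => ?_⟩
  -- Round `t` starts at some machine time `s ≥ t`, with a code `m` of `mem t` on the main stack.
  -- The bound `s ≥ t` later shows that the machine runs forever.
  have key : ∀ t ≤ T, ∃ s b m, t ≤ s ∧ val m = mem t ∧ (b = true → m = 0) ∧
      (machine (.cons ca cm) enc D B).run p s =
        some (cfg _ _ _ _ (.read b) t (K'.elim (if b then [] else trList [m]) [] [] [])
          (out t)) := by
    intro t
    induction t with
    | zero =>
      intro _
      refine ⟨0, true, 0, le_rfl, ?_, fun _ => rfl, ?_⟩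
      · rw [hmem]; simp [val]
      · rw [hout]
        have : (fun r => stackTape (K'.elim [] [] [] [] (tapeEquiv r))) =
            fun _ => (default : Turing.Tape (Option Γ')) := by
          funext r
          fin_cases r <;> rfl
        simp only [Type2Machine.run, cfg, if_true, this]
        rfl
    | succ t ih =>
      intro ht
      obtain ⟨s, b, m, hs, hm, hb, hrun⟩ := ih (by omega)
      obtain ⟨h₁, x, hx, h₂⟩ := hT t ht
      obtain ⟨s', hs', hrun'⟩ := Type2Machine.run_of_reaches
        (reaches_eval p hc (fun a m => hB _) hb t (out t)) hrun
      refine ⟨s' + 1, false, (f (fun j => (p j).symbolAt t) m).2, by omega, ?_, by simp,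
        (Type2Machine.run_succ hrun').trans ?_⟩
      · simp only [f, hm]
        rw [h₁]; simp [val]
      · rw [step_decode_some p (hB _) (x := x) (by rw [← hx, ← hm]; exact hD _), ← h₂]
        rfl
  obtain ⟨s, b, m, hs, hm, hb, hrun⟩ := key T le_rfl
  refine ⟨s, _, hs, hrun, rfl, fun hnone => ?_⟩
  obtain ⟨s', hs', hrun'⟩ := Type2Machine.run_of_reaches
    (reaches_eval p hc (fun a m => hB _) hb T (out T)) hrun
  exact ⟨s', _, hrun', step_decode_none p (hB _) (by rw [← hnone, ← hm]; exact hD _) _ _ _, rfl⟩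

/-! Approximation of functions on sequences by primitive recursive functions on words -/

/-! ### Primitive recursion on finite types and on the integers -/

section Primrec

/-- Some coding of a finite type. -/
@[reducible]
noncomputable def primcodableOfFinite (α : Type) [Finite α] : Primcodable α :=
  Primcodable.ofEquiv (Fin (Nat.card α)) (Finite.equivFin α)

/-- A finite case distinction: the index of `a` selects one of finitely many primitive recursive
functions. -/
theorem primrec₂_of_finite {α β γ : Type} [Finite α] [Primcodable α] [Primcodable β]
    [Primcodable γ] {f : α → β → γ} (h : ∀ a, Primrec (f a)) : Primrec₂ f := by
  have e := Finite.equivFin α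
  have h₁ : Primrec₂ fun (i : Fin (Nat.card α)) b => f (e.symm i) b :=
    Primrec.fin_curry₁.2 fun i => h _
  refine (h₁.comp ((Primrec.dom_finite e).comp .fst) .snd).of_eq fun x => ?_
  simp

theorem encode_int_ofNat (n : ℕ) : Encodable.encode (Int.ofNat n) = 2 * n := rfl

theorem encode_int_negSucc (n : ℕ) : Encodable.encode (Int.negSucc n) = 2 * n + 1 := rfl

/-- Nonnegative integers have even codes and negative ones odd codes, so the successor adds `2` to
an even code and subtracts `2` from an odd one. Truncated subtraction takes the code `1` of `-1` to
`0`, as it should. -/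
theorem primrec_int_succ : Primrec fun z : ℤ => z + 1 := by
  refine Primrec.encode_iff.1 ((Primrec.ite (c := fun z : ℤ => Encodable.encode z % 2 = 0)
    (Primrec.eq.comp (Primrec.nat_mod.comp .encode (.const 2)) (.const 0))
    (Primrec.nat_add.comp .encode (.const 2))
    (Primrec.nat_sub.comp .encode (.const 2))).of_eq fun z => ?_)
  rcases z with n | _ | n
  · have : (Int.ofNat n + 1) = Int.ofNat (n + 1) := rfl
    have e := encode_int_ofNat n
    have e' := encode_int_ofNat (n + 1)
    rw [this, if_pos (by omega)]
    omega
  · rfl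
  · have : (Int.negSucc (n + 1) + 1) = Int.negSucc n := rfl
    have e := encode_int_negSucc (n + 1)
    have e' := encode_int_negSucc n
    rw [this, if_neg (by omega)]
    omega

theorem primrec_int_pred : Primrec fun z : ℤ => z - 1 := by
  refine Primrec.encode_iff.1 ((Primrec.ite (c := fun z : ℤ => Encodable.encode z = 0)
    (Primrec.eq.comp .encode (.const 0)) (.const 1)
    (Primrec.ite (c := fun z : ℤ => Encodable.encode z % 2 = 0)
    (Primrec.eq.comp (Primrec.nat_mod.comp .encode (.const 2)) (.const 0))
    (Primrec.nat_sub.comp .encode (.const 2))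
    (Primrec.nat_add.comp .encode (.const 2)))).of_eq fun z => ?_)
  rcases z with (_ | n) | n
  · rfl
  · have : (Int.ofNat (n + 1) - 1) = Int.ofNat n := by simp
    have e := encode_int_ofNat (n + 1)
    have e' := encode_int_ofNat n
    rw [this, if_neg (by omega), if_pos (by omega)]
    omega
  · have : (Int.negSucc n - 1) = Int.negSucc (n + 1) := rfl
    have e := encode_int_negSucc n
    have e' := encode_int_negSucc (n + 1)
    rw [this, if_neg (by omega), if_neg (by omega)]
    omega

theorem primrec_int_toNat : Primrec Int.toNat := by
  refine (Primrec.ite (c := fun z : ℤ => Encodable.encode z % 2 = 0)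
    (Primrec.eq.comp (Primrec.nat_mod.comp .encode (.const 2)) (.const 0))
    (Primrec.nat_div.comp .encode (.const 2)) (.const 0)).of_eq fun z => ?_
  rcases z with n | n
  · have e := encode_int_ofNat n
    rw [if_pos (by omega), e]
    simp
  · have e := encode_int_negSucc n
    rw [if_neg (by omega)]
    rfl

theorem primrecPred_int_nonneg : PrimrecPred fun z : ℤ => 0 ≤ z := by
  refine (Primrec.eq.comp (Primrec.nat_mod.comp .encode (.const 2)) (.const 0)).of_eq
    (p := fun z : ℤ => Encodable.encode z % 2 = 0) fun z => ?_
  rcases z with n | n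
  · have e := encode_int_ofNat n
    simp only [Int.ofNat_eq_natCast] at e ⊢
    omega
  · rw [encode_int_negSucc]
    have := Int.negSucc_lt_zero n
    omega

end Primrec

variable {S : Type}

/-- The word `l` approximates a sequence: a word only approximates itself, and an infinite sequence
is approximated by its prefixes; `m` is a lower bound for their length. -/
def Approx : (t : Kind) → ℕ → List S → Str S t → Prop
  | .word, _, l, w => l = (w : List S)
  | .stream, m, l, q => m ≤ l.length ∧ ∀ i a, l[i]? = some a → a = (q : ℕ → S) i

theorem Approx.mono {t : Kind} {m m' : ℕ} {l : List S} {x : Str S t} (h : Approx t m l x)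
    (hm : m' ≤ m) : Approx t m' l x := by
  cases t
  · exact h
  · exact ⟨hm.trans h.1, h.2⟩

/-- `f` is approximated by a primitive recursive function on words: with the bound `N` for the
effort, it yields approximations of `f` from approximations of the arguments. -/
def Approximable [Primcodable S] {n : ℕ} (Y : Fin n → Kind) (Y₀ : Kind)
    (f : MultiFun (∀ j, Str S (Y j)) (Str S Y₀)) : Prop :=
  ∃ sim : ℕ → (Fin n → List S) → Option (List S), Primrec₂ sim ∧
    (∀ p, ∀ y ∈ f p, ∀ N ls, (∀ j, Approx (Y j) 0 (ls j) (p j)) →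
      ∀ l, sim N ls = some l → Approx Y₀ 0 l y) ∧
    ∀ p, ∀ y ∈ f p, ∀ m, ∃ m', ∀ N ≥ m', ∀ ls, (∀ j, Approx (Y j) m' (ls j) (p j)) →
      ∃ l, sim N ls = some l ∧ Approx Y₀ m l y

/-- The symbol in cell `z` of a tape with a sequence that is approximated by `l`; `none` if it is
unknown. -/
def lookup (t : Kind) (l : List S) (z : ℤ) : Option (Option S) :=
  if 0 ≤ z then
    match t with
    | .word => some l[z.toNat]?
    | .stream => l[z.toNat]?.map some
  else some none

theorem primrec_lookup [Primcodable S] (t : Kind) : Primrec₂ (lookup (S := S) t) := by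
  have h : Primrec₂ fun (l : List S) (z : ℤ) => l[z.toNat]? :=
    Primrec.list_getElem?.comp .fst (primrec_int_toNat.comp .snd)
  refine Primrec.ite (primrecPred_int_nonneg.comp .snd) ?_ (.const _)
  cases t
  · exact Primrec.option_some.comp h
  · exact Primrec.option_map h (Primrec.option_some.comp .snd).to₂

theorem Approx.lookup_sound {t : Kind} {l : List S} {x : Str S t} (h : Approx t 0 l x) {z : ℤ}
    {a : Option S} (ha : lookup t l z = some a) : x.symbolAt z = a := by
  unfold lookup at ha
  cases t
  · obtain rfl : l = x := h
    split_ifs at ha with hz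
    · simpa [Str.symbolAt, hz] using ha
    · simpa [Str.symbolAt, hz] using ha
  · split_ifs at ha with hz
    · obtain ⟨b, hb, rfl⟩ := Option.map_eq_some_iff.1 ha
      simpa [Str.symbolAt, hz] using (h.2 _ _ hb).symm
    · simpa [Str.symbolAt, hz] using ha

theorem Approx.lookup_ne_none {t : Kind} {m : ℕ} {l : List S} {x : Str S t} (h : Approx t m l x)
    {z : ℤ} (hz : z < m) : lookup t l z ≠ none := by
  unfold lookup
  split_ifs with h₀
  · cases t
    · simp
    · have := h.1
      have h₁ : z.toNat < l.length := by omega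
      simp [h₁]
  · simp

/-! Computable functions are approximable -/

namespace Type2Machine

open Turing

instance : Finite Dir := Finite.of_surjective (fun b : Bool => if b then Dir.left else Dir.right)
  fun d => by cases d <;> simp

noncomputable local instance : Primcodable Dir := primcodableOfFinite Dir

theorem primrec_shift : Primrec₂ fun (d : Option Dir) (z : ℤ) => z + shift d := by
  refine primrec₂_of_finite fun d => ?_
  rcases d with _ | _ | _
  · exact Primrec.id.of_eq fun z => (add_zero z).symm
  · exact primrec_int_pred
  · exact primrec_int_succ

section Zipper

variable {W : Type} [Inhabited W]

/-- A tape, given by the inscription to the left of the head (in reverse) and from the head on. -/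
def zipTape (x : List W × List W) : Tape W := Tape.mk' (ListBlank.mk x.1) (ListBlank.mk x.2)

/-- Write under the head, then move. -/
def zipMove : Option Dir → W → List W × List W → List W × List W
  | none, a, x => (x.1, a :: x.2.tail)
  | some .left, a, x => (x.1.tail, x.1.headI :: a :: x.2.tail)
  | some .right, a, x => (a :: x.1, x.2.tail)

theorem zipTape_move (d : Option Dir) (a : W) (x : List W × List W) :
    zipTape (zipMove d a x) = moveTape d ((zipTape x).write a) := by
  rcases d with _ | _ | _ <;> simp [zipTape, zipMove, moveTape]

theorem primrec_zipMove [Primcodable W] :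
    Primrec fun x : (W × Option Dir) × (List W × List W) => zipMove x.1.2 x.1.1 x.2 := by
  have h : Primrec₂ fun (d : Option Dir) (x : W × List W × List W) => zipMove d x.1 x.2 := by
    refine primrec₂_of_finite fun d => ?_
    have h₁ : Primrec fun x : W × List W × List W => x.2.1 := Primrec.fst.comp .snd
    have h₂ : Primrec fun x : W × List W × List W => x.2.2.tail :=
      Primrec.list_tail.comp (Primrec.snd.comp .snd)
    have h₃ : Primrec fun x : W × List W × List W => x.1 := Primrec.fst
    rcases d with _ | _ | _
    · exact h₁.pair (Primrec.list_cons.comp h₃ h₂)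
    · exact (Primrec.list_tail.comp h₁).pair (Primrec.list_cons.comp (Primrec.list_headI.comp h₁)
        (Primrec.list_cons.comp h₃ h₂))
    · exact (Primrec.list_cons.comp h₃ h₁).pair h₂
  exact h.comp (Primrec.snd.comp .fst) ((Primrec.fst.comp .fst).pair .snd)

end Zipper

variable {S : Type} {n : ℕ} (M : Type2Machine S n)

/-- Configurations, in a form that can be coded. -/
abbrev Sim : Type :=
  M.State × (Fin n → ℤ) × (Fin M.numWork → List M.Work × List M.Work) × List S

/-- Actions, in a form that can be coded. -/
abbrev RawAction : Type :=
  M.State × (Fin n → Option Dir) × (Fin M.numWork → M.Work × Option Dir) × Option S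

variable {M}

/-- The configuration that is coded. -/
def Sim.toCfg (c : M.Sim) : M.Cfg where
  state := c.1
  inHead := c.2.1
  work r := zipTape (c.2.2.1 r)
  out := c.2.2.2

/-- Perform an action. -/
def Sim.apply (c : M.Sim) (a : M.RawAction) : M.Sim :=
  (a.1, fun j => c.2.1 j + shift (a.2.1 j),
    fun r => zipMove (a.2.2.1 r).2 (a.2.2.1 r).1 (c.2.2.1 r), c.2.2.2 ++ a.2.2.2.toList)

variable (M) in
open Classical in
/-- The transition function for partially known symbols on the input tapes. -/
noncomputable def rawTrans
    (x : M.State × (Fin n → Option (Option S)) × (Fin M.numWork → M.Work)) :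
    Option (Option M.RawAction) :=
  if ∀ j, x.2.1 j ≠ none then
    some ((M.δ x.1 (fun j => (x.2.1 j).getD none) x.2.2).map fun a =>
      (a.next, a.inMove, fun r => (a.write r, a.workMove r), a.out))
  else none

variable (Y : Fin n → Kind)

/-- One step on partially known inputs: `none` if unknown symbols are needed, and `some none` if the
machine halts. -/
noncomputable def simStep (ls : Fin n → List S) (c : M.Sim) : Option (Option M.Sim) :=
  (rawTrans M (c.1, fun j => lookup (Y j) (ls j) (c.2.1 j), fun r => (c.2.2.1 r).2.headI)).map
    fun o => o.map c.apply

/-- One step if it is possible. -/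
noncomputable def simNext (ls : Fin n → List S) (c : M.Sim) : M.Sim :=
  ((simStep Y ls c).getD none).getD c

variable (M) in
/-- The initial configuration. -/
def simInit : M.Sim := (M.start, fun _ => 0, fun _ => ([], []), [])

variable (M) in
/-- The result of `N` steps on partially known inputs. -/
noncomputable def sim : Kind → ℕ → (Fin n → List S) → Option (List S)
  | .word, N, ls =>
      (simStep Y ls ((simNext Y ls)^[N] (simInit M))).bind fun o =>
        o.elim (some ((simNext Y ls)^[N] (simInit M)).2.2.2) fun _ => none
  | .stream, N, ls => some ((simNext Y ls)^[N] (simInit M)).2.2.2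

section Primrec

variable [Primcodable S] [Primcodable M.State] [Primcodable M.Work]

theorem primrec_apply : Primrec₂ (Sim.apply (M := M)) := by
  have hc : Primrec fun x : M.Sim × M.RawAction => x.1 := Primrec.fst
  have ha : Primrec fun x : M.Sim × M.RawAction => x.2 := Primrec.snd
  refine (Primrec.fst.comp ha).pair (.pair ?_ (.pair ?_ ?_))
  · refine Primrec.fin_curry.2 (Primrec₂.mk ?_)
    exact primrec_shift.comp
      (Primrec.fin_app.comp (Primrec.fst.comp (Primrec.snd.comp (ha.comp .fst))) .snd)
      (Primrec.fin_app.comp (Primrec.fst.comp (Primrec.snd.comp (hc.comp .fst))) .snd)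
  · refine Primrec.fin_curry.2 (Primrec₂.mk ?_)
    exact primrec_zipMove.comp (.pair
      (Primrec.fin_app.comp
        (Primrec.fst.comp (Primrec.snd.comp (Primrec.snd.comp (ha.comp .fst)))) .snd)
      (Primrec.fin_app.comp
        (Primrec.fst.comp (Primrec.snd.comp (Primrec.snd.comp (hc.comp .fst)))) .snd))
  · exact Primrec.list_append.comp (Primrec.snd.comp (Primrec.snd.comp (Primrec.snd.comp hc)))
      (Primrec.optionToList.comp (Primrec.snd.comp (Primrec.snd.comp (Primrec.snd.comp ha))))

variable [Finite S]

/-- The transition table has a finite domain, so it is primitive recursive whatever it is; only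
looking up symbols and applying the action involve unbounded data. -/
theorem primrec_simStep : Primrec₂ (simStep (M := M) Y) := by
  refine Primrec.option_map ((Primrec.dom_finite (rawTrans M)).comp (.pair ?_ (.pair ?_ ?_)))
    (Primrec.option_map .snd
      (primrec_apply.comp (Primrec.snd.comp (Primrec.fst.comp .fst)) .snd).to₂).to₂
  · exact Primrec.fst.comp .snd
  · refine Primrec.fin_curry.2 (Primrec₂.swap (Primrec.fin_curry₁.2 fun j => ?_))
    exact (primrec_lookup (Y j)).comp (Primrec.fin_app.comp .fst (.const j))
      (Primrec.fin_app.comp (Primrec.fst.comp (Primrec.snd.comp .snd)) (.const j))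
  · refine Primrec.fin_curry.2 (Primrec₂.mk ?_)
    exact Primrec.list_headI.comp (Primrec.snd.comp (Primrec.fin_app.comp (Primrec.fst.comp
      (Primrec.snd.comp (Primrec.snd.comp (Primrec.snd.comp .fst)))) .snd))

theorem primrec_simNext : Primrec₂ (simNext (M := M) Y) :=
  Primrec.option_getD.comp (Primrec.option_getD.comp (primrec_simStep Y) (.const none)) .snd

theorem primrec_sim (Y₀ : Kind) : Primrec₂ (sim M Y Y₀) := by
  have h : Primrec₂ fun (N : ℕ) ls => (simNext Y ls)^[N] (simInit M) :=
    Primrec.nat_iterate .fst (.const _)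
      ((primrec_simNext Y).comp (Primrec.snd.comp .fst) .snd).to₂
  have h' : Primrec₂ fun (N : ℕ) ls => ((simNext Y ls)^[N] (simInit M)).2.2.2 :=
    Primrec.snd.comp (Primrec.snd.comp (Primrec.snd.comp h))
  cases Y₀
  · refine Primrec.option_bind ((primrec_simStep Y).comp .snd h) (Primrec₂.mk ?_)
    refine (Primrec.option_casesOn (f := fun x : (ℕ × (Fin n → List S)) × Option M.Sim =>
      some ((simNext Y x.1.2)^[x.1.1] (simInit M)).2.2.2) (g := fun _ _ => none) .snd
      (Primrec.option_some.comp (h'.comp (Primrec.fst.comp .fst) (Primrec.snd.comp .fst)))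
      (.const _)).of_eq ?_
    rintro ⟨x, _ | _⟩ <;> rfl
  · exact Primrec.option_some.comp h'

end Primrec

/-! ### Soundness and completeness of the bounded simulation -/

section Correctness

variable {Y} {p : ∀ j, Str S (Y j)} {ls : Fin n → List S}

theorem simStep_sound (h : ∀ j, Approx (Y j) 0 (ls j) (p j)) {c : M.Sim} {o : Option M.Sim}
    (ho : simStep Y ls c = some o) : M.step p c.toCfg = o.map Sim.toCfg := by
  obtain ⟨o', h₁, rfl⟩ := Option.map_eq_some_iff.1 ho
  unfold rawTrans at h₁
  split_ifs at h₁ with h₂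
  obtain rfl := Option.some_inj.1 h₁
  have e : (fun j => (lookup (Y j) (ls j) (c.2.1 j)).getD none) =
      fun j => (p j).symbolAt (c.2.1 j) := by
    funext j
    obtain ⟨a, ha⟩ := Option.ne_none_iff_exists'.1 (h₂ j)
    simp only at ha
    rw [ha, (h j).lookup_sound ha]
    rfl
  simp only [e]
  rw [step]
  have e' : (M.δ c.toCfg.state (fun j => (p j).symbolAt (c.toCfg.inHead j))
      (fun r => (c.toCfg.work r).head)) = M.δ c.1 (fun j => (p j).symbolAt (c.2.1 j))
        (fun r => (c.2.2.1 r).2.headI) := rfl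
  rw [e']
  cases M.δ c.1 (fun j => (p j).symbolAt (c.2.1 j)) (fun r => (c.2.2.1 r).2.headI) with
  | none => rfl
  | some a =>
    simp only [Option.map_some, Sim.apply, Sim.toCfg, zipTape_move]

theorem simStep_ne_none {m : ℕ} (h : ∀ j, Approx (Y j) m (ls j) (p j)) {c : M.Sim}
    (hc : ∀ j, c.2.1 j < m) : simStep Y ls c ≠ none := by
  have : ∀ j, lookup (Y j) (ls j) (c.2.1 j) ≠ none := fun j => (h j).lookup_ne_none (hc j)
  simp [simStep, rawTrans, this]

/-- The simulation stalls at unknown symbols and after halting, so `N` iterations may amount to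
fewer steps, but always to a genuine configuration. -/
theorem exists_run_simNext (h : ∀ j, Approx (Y j) 0 (ls j) (p j)) (N : ℕ) :
    ∃ s, M.run p s = some ((simNext Y ls)^[N] (simInit M)).toCfg := by
  induction N with
  | zero => exact ⟨0, rfl⟩
  | succ N ih =>
    obtain ⟨s, hs⟩ := ih
    rw [Function.iterate_succ_apply', simNext]
    set c := (simNext Y ls)^[N] (simInit M)
    rcases e : simStep Y ls c with _ | _ | c'
    · exact ⟨s, hs⟩
    · exact ⟨s, hs⟩
    · exact ⟨s + 1, (run_succ hs).trans (simStep_sound h e)⟩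

/-- A head moves by at most one cell per step, so the first `s` steps scan only cells below `s`;
these are known at precision `m ≥ s`, and no step stalls. -/
theorem run_eq_simNext {s : ℕ} {c : M.Cfg} (hc : M.run p s = some c) {m : ℕ} (hm : s ≤ m)
    (h : ∀ j, Approx (Y j) m (ls j) (p j)) :
    ((simNext Y ls)^[s] (simInit M)).toCfg = c ∧
      ∀ j, ((simNext Y ls)^[s] (simInit M)).2.1 j ≤ s := by
  induction s generalizing c with
  | zero =>
    exact ⟨Option.some_inj.1 hc, fun j => le_rfl⟩
  | succ s ih =>
    rw [run] at hc
    obtain ⟨c₀, h₀, h₁⟩ := Option.bind_eq_some_iff.1 hc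
    obtain ⟨h₂, h₃⟩ := ih h₀ (by omega)
    rw [Function.iterate_succ_apply', simNext]
    set d := (simNext Y ls)^[s] (simInit M)
    obtain ⟨o, ho⟩ := Option.ne_none_iff_exists'.1
      (simStep_ne_none h (c := d) fun j => (h₃ j).trans_lt (by exact_mod_cast hm))
    have h₄ := simStep_sound (fun j => (h j).mono (Nat.zero_le _)) ho
    rw [h₂, h₁] at h₄
    obtain ⟨c', rfl, rfl⟩ := Option.map_eq_some_iff.1 h₄.symm
    rw [ho]
    refine ⟨rfl, fun j => ?_⟩
    obtain ⟨o', -, h₅⟩ := Option.map_eq_some_iff.1 ho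
    obtain ⟨a, rfl, rfl⟩ := Option.map_eq_some_iff.1 h₅
    have h₆ := h₃ j
    simp only [Option.getD_some, Sim.apply]
    have : shift (a.2.1 j) ≤ 1 := by rcases a.2.1 j with _ | _ | _ <;> simp [shift]
    push_cast
    omega

theorem run_eq_none_of_step {s s' : ℕ} {c : M.Cfg} (h : M.run p s = some c)
    (hc : M.step p c = none) (hs : s < s') : M.run p s' = none := by
  induction s', hs using Nat.le_induction with
  | base => rw [Nat.succ_eq_add_one, run_succ h, hc]
  | succ s' _ ih => rw [run, ih]; rfl

theorem halting_unique {s s' : ℕ} {c c' : M.Cfg} (h : M.run p s = some c)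
    (hc : M.step p c = none) (h' : M.run p s' = some c') (hc' : M.step p c' = none) : c = c' := by
  rcases lt_trichotomy s s' with hlt | rfl | hlt
  · simp [run_eq_none_of_step h hc hlt] at h'
  · exact Option.some_inj.1 (h.symm.trans h')
  · simp [run_eq_none_of_step h' hc' hlt] at h

theorem out_prefix_of_step {c c' : M.Cfg} (h : M.step p c = some c') : c.out <+: c'.out := by
  obtain ⟨a, -, rfl⟩ := Option.map_eq_some_iff.1 h
  exact List.prefix_append _ _

theorem out_prefix_of_run {s s' : ℕ} (hs : s ≤ s') {c c' : M.Cfg} (h : M.run p s = some c)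
    (h' : M.run p s' = some c') : c.out <+: c'.out := by
  induction s', hs using Nat.le_induction generalizing c' with
  | base =>
    obtain rfl := Option.some_inj.1 (h.symm.trans h')
    exact List.prefix_rfl
  | succ s' _ ih =>
    rw [run] at h'
    obtain ⟨c₀, h₀, h₁⟩ := Option.bind_eq_some_iff.1 h'
    exact (ih h₀).trans (out_prefix_of_step h₁)

theorem out_prefix_simNext (h : ∀ j, Approx (Y j) 0 (ls j) (p j)) (c : M.Sim) :
    c.2.2.2 <+: (simNext Y ls c).2.2.2 := by
  rw [simNext]
  rcases e : simStep Y ls c with _ | _ | c'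
  · exact List.prefix_rfl
  · exact List.prefix_rfl
  · exact out_prefix_of_step (simStep_sound h e)

theorem getElem?_of_prefix {l l' : List S} (h : l <+: l') {i : ℕ} {a : S} (ha : l[i]? = some a) :
    l'[i]? = some a := by
  obtain ⟨t, rfl⟩ := h
  rw [List.getElem?_append_left (List.getElem?_eq_some_iff.1 ha).1, ha]

/-- For words, the halting configuration is unique. For sequences, the outputs at two times of one
run are comparable as prefixes. -/
theorem sim_sound {Y₀ : Kind} {y : Str S Y₀} (hy : y ∈ M.fn Y Y₀ p) {N : ℕ}
    (h : ∀ j, Approx (Y j) 0 (ls j) (p j)) {l : List S} (hl : sim M Y Y₀ N ls = some l) :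
    Approx Y₀ 0 l y := by
  obtain ⟨s, hs⟩ := exists_run_simNext (M := M) h N
  cases Y₀ with
  | word =>
    obtain ⟨s', c, h₁, h₂, h₃⟩ := hy
    obtain ⟨o, ho, h₄⟩ := Option.bind_eq_some_iff.1 hl
    cases o with
    | some _ => simp at h₄
    | none =>
      have h₅ := halting_unique hs (simStep_sound h ho) h₁ h₂
      rw [← h₃, ← h₅]
      exact (Option.some_inj.1 h₄).symm
  | stream =>
    obtain ⟨-, h₁⟩ := hy
    obtain rfl := Option.some_inj.1 hl
    refine ⟨Nat.zero_le _, fun i a ha => ?_⟩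
    obtain ⟨s', c, h₂, h₃⟩ := h₁ i
    rcases le_total s s' with hle | hle
    · have := getElem?_of_prefix (out_prefix_of_run hle hs h₂) ha
      exact Option.some_inj.1 (this.symm.trans h₃)
    · have := getElem?_of_prefix (out_prefix_of_run hle h₂ hs) h₃
      exact Option.some_inj.1 (ha.symm.trans this)

theorem fn_approximable [Finite S] [Primcodable S] (M : Type2Machine S n) (Y₀ : Kind) :
    Approximable Y Y₀ (M.fn Y Y₀) := by
  let := primcodableOfFinite M.State
  let := primcodableOfFinite M.Work
  refine ⟨sim M Y Y₀, primrec_sim Y Y₀, fun p y hy N ls h l hl => sim_sound hy h hl,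
    fun p y hy m => ?_⟩
  cases Y₀ with
  | word =>
    obtain ⟨s, c, h₁, h₂, h₃⟩ := hy
    -- One more than `s`, because halting is decided by the symbols scanned after `s` steps.
    refine ⟨s + 1, fun N hN ls h => ?_⟩
    obtain ⟨h₄, h₅⟩ := run_eq_simNext h₁ (Nat.le_succ s) h
    set d := (simNext Y ls)^[s] (simInit M) with hd
    obtain ⟨o, ho⟩ := Option.ne_none_iff_exists'.1
      (simStep_ne_none h (c := d) fun j => (h₅ j).trans_lt (by push_cast; omega))
    have h₆ := simStep_sound (fun j => (h j).mono (Nat.zero_le _)) ho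
    rw [h₄, h₂] at h₆
    obtain rfl := Option.map_eq_none_iff.1 h₆.symm
    -- A halting configuration is a fixed point of `simNext`, so further effort changes nothing.
    have h₇ : (simNext Y ls)^[N] (simInit M) = d := by
      obtain ⟨k, rfl⟩ := Nat.exists_eq_add_of_le' (show s ≤ N by omega)
      rw [Function.iterate_add_apply]
      exact Function.iterate_fixed (by rw [simNext, ← hd, ho]; rfl) k
    refine ⟨d.2.2.2, ?_, ?_⟩
    · rw [sim, h₇, ho]
      rfl
    · rw [← h₃, ← h₄]
      rfl
  | stream =>
    obtain ⟨s, c, h₁, h₂⟩ := hy.2 m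
    refine ⟨s, fun N hN ls h => ⟨_, rfl, ?_, ?_⟩⟩
    · obtain ⟨h₄, -⟩ := run_eq_simNext h₁ le_rfl h
      obtain ⟨k, rfl⟩ := Nat.exists_eq_add_of_le' hN
      have h₅ : ∀ k, c.out <+: ((simNext Y ls)^[k + s] (simInit M)).2.2.2 := by
        intro k
        induction k with
        | zero => rw [Nat.zero_add, ← h₄]; exact List.prefix_rfl
        | succ k ih =>
          rw [Nat.succ_add, Function.iterate_succ_apply']
          exact ih.trans (out_prefix_simNext (fun j => (h j).mono (Nat.zero_le _)) _)
      exact ((List.getElem?_eq_some_iff.1 h₂).1.le).trans (h₅ k).length_le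
    · exact (sim_sound hy (N := N) (fun j => (h j).mono (Nat.zero_le _)) rfl).2

end Correctness

end Type2Machine

theorem Approximable.mono {S : Type} [Primcodable S] {n : ℕ} {Y : Fin n → Kind} {Y₀ : Kind}
    {f g : MultiFun (∀ j, Str S (Y j)) (Str S Y₀)} (hg : Approximable Y Y₀ g)
    (h : ∀ p, f p ⊆ g p) : Approximable Y Y₀ f := by
  obtain ⟨sim, h₁, h₂, h₃⟩ := hg
  exact ⟨sim, h₁, fun p y hy => h₂ p y (h p hy), fun p y hy => h₃ p y (h p hy)⟩

theorem IsComputable.approximable {S : Type} [Finite S] [Primcodable S] {n : ℕ} {Y : Fin n → Kind}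
    {Y₀ : Kind} {f : MultiFun (∀ j, Str S (Y j)) (Str S Y₀)} (hf : IsComputable Y Y₀ f) :
    Approximable Y Y₀ f := by
  obtain ⟨-, _, ⟨M, rfl⟩, h⟩ := hf
  exact (M.fn_approximable Y₀).mono h

/-! Generalized Turing machines with approximable functions -/

theorem primrec_update {α : Type} [Primcodable α] {n : ℕ} (i : Fin n) :
    Primrec₂ fun (f : Fin n → α) (a : α) => Function.update f i a := by
  refine Primrec.fin_curry.2 (Primrec₂.swap (Primrec.fin_curry₁.2 fun j => ?_))
  by_cases h : j = i
  · subst h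
    simpa using Primrec.snd
  · simp only [Function.update_of_ne h]
    exact Primrec.fin_app.comp .fst (.const j)

theorem primrec_option_elim {α β γ : Type} [Primcodable α] [Primcodable β] [Primcodable γ]
    {o : α → Option β} {f : α → γ} {g : α → β → γ} (ho : Primrec o) (hf : Primrec f)
    (hg : Primrec₂ g) : Primrec fun a => (o a).elim (f a) (g a) :=
  (Primrec.option_casesOn ho hf hg).of_eq fun a => by cases o a <;> rfl

theorem primrec_sum_elim {α β β' γ : Type} [Primcodable α] [Primcodable β] [Primcodable β']
    [Primcodable γ] {o : α → β ⊕ β'} {f : α → β → γ} {g : α → β' → γ} (ho : Primrec o)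
    (hf : Primrec₂ f) (hg : Primrec₂ g) : Primrec fun a => (o a).elim (f a) (g a) :=
  (Primrec.sumCasesOn ho hf hg).of_eq fun a => by cases o a <;> rfl

namespace GTM

variable {S : Type} {zero one : S} {k L : ℕ} {Y : Fin (L + 1) → Kind}

/-- Approximation of the content of a cell. -/
def CellApprox {Γ : Type} (t : Kind) (m : ℕ) : List S ⊕ Γ → Str S t ⊕ Γ → Prop
  | .inl l, .inl x => Approx t m l x
  | .inr a, .inr b => a = b
  | _, _ => False

theorem CellApprox.exists_inl {Γ : Type} {t : Kind} {m : ℕ} {c : List S ⊕ Γ} {x : Str S t}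
    (h : CellApprox t m c (.inl x)) : ∃ l, c = .inl l ∧ Approx t m l x := by
  cases c
  · exact ⟨_, rfl, h⟩
  · exact h.elim

theorem CellApprox.mono {Γ : Type} {t : Kind} {m m' : ℕ} {c : List S ⊕ Γ} {x : Str S t ⊕ Γ}
    (h : CellApprox t m c x) (hm : m' ≤ m) : CellApprox t m' c x := by
  cases c <;> cases x
  · exact Approx.mono h hm
  · exact h
  · exact h
  · exact h

theorem CellApprox.eq_inr_iff {Γ : Type} {t : Kind} {m : ℕ} {c : List S ⊕ Γ} {x : Str S t ⊕ Γ}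
    (h : CellApprox t m c x) (a : Γ) : c = .inr a ↔ x = .inr a := by
  cases c <;> cases x <;> simp_all [CellApprox]

/-- The content of cell `z` of a tape that is given by a list of all changes, the last one first. -/
def readCell {Γ C : Type} (b : Γ) (l : List (ℤ × (C ⊕ Γ))) (z : ℤ) : C ⊕ Γ :=
  l.foldr (fun x c => if x.1 = z then x.2 else c) (.inr b)

theorem readCell_cons {Γ C : Type} (b : Γ) (y : ℤ) (x : C ⊕ Γ) (l : List (ℤ × (C ⊕ Γ))) (z : ℤ) :
    readCell b ((y, x) :: l) z = if z = y then x else readCell b l z := by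
  simp [readCell, eq_comm]

theorem primrec_readCell {Γ C : Type} [Primcodable Γ] [Primcodable C] (b : Γ) :
    Primrec₂ (readCell (C := C) b) :=
  Primrec.list_foldr .fst (.const _) (Primrec.ite
    (Primrec.eq.comp (Primrec.fst.comp (Primrec.fst.comp .snd)) (Primrec.snd.comp .fst))
    (Primrec.snd.comp (Primrec.fst.comp .snd)) (Primrec.snd.comp .snd)).to₂

variable (N : GTM zero one k L (fun i => Str S (Y i)))

/-- Configurations with approximations of sequences, in a form that can be coded. -/
abbrev Sim : Type :=
  N.Lab × (Fin (L + 1) → ℤ) × (Fin (L + 1) → List (ℤ × (List S ⊕ N.Γ)))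

namespace Sim

variable {N}

/-- The content of the scanned cell. -/
def scan (c : N.Sim) (i : Fin (L + 1)) : List S ⊕ N.Γ := readCell N.blank (c.2.2 i) (c.2.1 i)

/-- The approximation of a sequence in the scanned cell. -/
def arg (c : N.Sim) (i : Fin (L + 1)) : List S := (c.scan i).elim id fun _ => []

def setLabel (c : N.Sim) (l : N.Lab) : N.Sim := (l, c.2)

def setHead (c : N.Sim) (i : Fin (L + 1)) (z : ℤ) : N.Sim :=
  (c.1, Function.update c.2.1 i z, c.2.2)

def setCell (c : N.Sim) (i : Fin (L + 1)) (x : List S ⊕ N.Γ) : N.Sim :=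
  (c.1, c.2.1, Function.update c.2.2 i ((c.2.1 i, x) :: c.2.2 i))

/-- The configuration `κ` is approximated by `c`. -/
structure Rep (m : ℕ) (c : N.Sim) (κ : N.Cfg) : Prop where
  label : c.1 = κ.label
  head : c.2.1 = κ.head
  tape : ∀ i z, CellApprox (Y i) m (readCell N.blank (c.2.2 i) z) (κ.tape i z)

variable {m m' : ℕ} {c : N.Sim} {κ : N.Cfg}

theorem Rep.mono (h : Rep m c κ) (hm : m' ≤ m) : Rep m' c κ :=
  ⟨h.label, h.head, fun i z => (h.tape i z).mono hm⟩

theorem Rep.setLabel (h : Rep m c κ) (l : N.Lab) : Rep m (c.setLabel l) (κ.setLabel l) :=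
  ⟨rfl, h.head, h.tape⟩

theorem Rep.setHead (h : Rep m c κ) (i : Fin (L + 1)) (z : ℤ) :
    Rep m (c.setHead i z) (κ.setHead i z) :=
  ⟨h.label, by simp [Sim.setHead, Cfg.setHead, h.head], h.tape⟩

theorem Rep.scan (h : Rep m c κ) (i : Fin (L + 1)) : CellApprox (Y i) m (c.scan i) (κ.scan i) := by
  have := h.tape i (κ.head i)
  rw [← h.head] at this
  rw [Sim.scan, Cfg.scan, ← h.head]
  exact this

theorem Rep.arg (h : Rep m c κ) {i : Fin (L + 1)} {x : Str S (Y i)} (hx : κ.scan i = .inl x) :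
    Approx (Y i) m (c.arg i) x := by
  have := h.scan i
  rw [hx] at this
  obtain ⟨l, hl, h'⟩ := this.exists_inl
  rwa [Sim.arg, hl]

theorem Rep.setCell (h : Rep m c κ) (i : Fin (L + 1)) {x : List S ⊕ N.Γ} {y : Str S (Y i) ⊕ N.Γ}
    (hx : CellApprox (Y i) m x y) : Rep m (c.setCell i x) (κ.setCell i y) := by
  refine ⟨h.label, h.head, fun j z => ?_⟩
  by_cases hj : j = i
  · subst hj
    simp only [Sim.setCell, Cfg.setCell, Function.update_self, readCell_cons, h.head]
    by_cases hz : z = κ.head j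
    · subst hz
      simpa using hx
    · simpa [hz] using h.tape j z
  · simpa [Sim.setCell, Cfg.setCell, Function.update_of_ne hj] using h.tape j z

section Primrec

variable [Primcodable S] [Primcodable N.Lab] [Primcodable N.Γ]

theorem primrec_scan (i : Fin (L + 1)) : Primrec fun c : N.Sim => c.scan i :=
  (primrec_readCell N.blank).comp
    (Primrec.fin_app.comp (Primrec.snd.comp .snd) (.const i))
    (Primrec.fin_app.comp (Primrec.fst.comp .snd) (.const i))

theorem primrec_arg (i : Fin (L + 1)) : Primrec fun c : N.Sim => c.arg i :=
  primrec_sum_elim (primrec_scan i) Primrec₂.right (.const [])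

theorem primrec_setLabel : Primrec₂ (setLabel (N := N)) := Primrec.snd.pair (Primrec.snd.comp .fst)

theorem primrec_setHead (i : Fin (L + 1)) :
    Primrec₂ fun (c : N.Sim) (z : ℤ) => c.setHead i z :=
  (Primrec.fst.comp .fst).pair (.pair
    ((primrec_update i).comp (Primrec.fst.comp (Primrec.snd.comp .fst)) .snd)
    (Primrec.snd.comp (Primrec.snd.comp .fst)))

theorem primrec_head (i : Fin (L + 1)) : Primrec fun c : N.Sim => c.2.1 i :=
  Primrec.fin_app.comp (Primrec.fst.comp .snd) (.const i)

theorem primrec_setCell (i : Fin (L + 1)) :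
    Primrec₂ fun (c : N.Sim) (x : List S ⊕ N.Γ) => c.setCell i x :=
  (Primrec.fst.comp .fst).pair (.pair (Primrec.fst.comp (Primrec.snd.comp .fst))
    ((primrec_update i).comp (Primrec.snd.comp (Primrec.snd.comp .fst))
      (Primrec.list_cons.comp (((primrec_head i).comp .fst).pair .snd)
        (Primrec.fin_app.comp (Primrec.snd.comp (Primrec.snd.comp .fst)) (.const i)))))

end Primrec

end Sim

variable {N}

/-- `g` approximates the execution of a statement. -/
structure Simulates (q : Stm zero one N.Lab N.Γ (fun i => Str S (Y i))) (g : ℕ → N.Sim → N.Sim) :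
    Prop where
  sound : ∀ {κ κ' : N.Cfg}, N.StmStep κ κ' q → ∀ n c, Sim.Rep 0 c κ →
    g n c = c ∨ Sim.Rep 0 (g n c) κ'
  complete : ∀ {κ κ' : N.Cfg}, N.StmStep κ κ' q → ∀ m, ∃ m', ∀ n ≥ m', ∀ c, Sim.Rep m' c κ →
    Sim.Rep m (g n c) κ'

theorem Simulates.of_forall {q : Stm zero one N.Lab N.Γ (fun i => Str S (Y i))} {g : N.Sim → N.Sim}
    (h : ∀ κ κ', N.StmStep κ κ' q → ∀ m c, Sim.Rep m c κ → Sim.Rep m (g c) κ') :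
    Simulates q fun _ => g :=
  ⟨fun hκ _ c hc => .inr (h _ _ hκ 0 c hc), fun hκ m => ⟨m, fun _ _ c hc => h _ _ hκ m c hc⟩⟩

/-- Labels, heads and symbols of `Γ` are represented exactly, so moving, writing and branching lose
no precision. Assignments and tests stall while the approximation gives no answer. The outcome of a
test is a word, hence exact once it is known, and comparison with `[zero]` decides it. -/
theorem exists_simulates [Primcodable S] [Primcodable N.Lab] [Primcodable N.Γ] (h01 : zero ≠ one)
    (q : Stm zero one N.Lab N.Γ (fun i => Str S (Y i)))
    (hq : q.Uses fun Z Z₀ f => Approximable Z Z₀ f) :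
    ∃ g : ℕ → N.Sim → N.Sim, Primrec₂ g ∧ Simulates q g := by
  classical
  cases q with
  | right i l' =>
    refine ⟨fun _ c => (c.setHead i (c.2.1 i + 1)).setLabel l', ?_, .of_forall ?_⟩
    · exact Sim.primrec_setLabel.comp ((Sim.primrec_setHead i).comp .snd
        (primrec_int_succ.comp ((Sim.primrec_head i).comp .snd))) (.const l')
    · rintro κ κ' rfl m c hc
      rw [hc.head]
      exact (hc.setHead i _).setLabel l'
  | left i l' =>
    refine ⟨fun _ c => (c.setHead i (c.2.1 i - 1)).setLabel l', ?_, .of_forall ?_⟩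
    · exact Sim.primrec_setLabel.comp ((Sim.primrec_setHead i).comp .snd
        (primrec_int_pred.comp ((Sim.primrec_head i).comp .snd))) (.const l')
    · rintro κ κ' rfl m c hc
      rw [hc.head]
      exact (hc.setHead i _).setLabel l'
  | write i a l' =>
    refine ⟨fun _ c => (c.setCell i (.inr a)).setLabel l', ?_, .of_forall ?_⟩
    · exact Sim.primrec_setLabel.comp ((Sim.primrec_setCell i).comp .snd (.const _)) (.const l')
    · rintro κ κ' rfl m c hc
      exact (hc.setCell i (x := .inr a) (y := .inr a) rfl).setLabel l'
  | branch i a l' l'' =>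
    refine ⟨fun _ c => c.setLabel (if c.scan i = .inr a then l' else l''), ?_, .of_forall ?_⟩
    · exact Sim.primrec_setLabel.comp .snd (Primrec.ite
        (Primrec.eq.comp ((Sim.primrec_scan i).comp .snd) (.const _)) (.const _) (.const _))
    · rintro κ κ' (⟨ha, rfl⟩ | ⟨ha, rfl⟩) m c hc
      · rw [if_pos (((hc.scan i).eq_inr_iff a).2 ha)]
        exact hc.setLabel l'
      · rw [if_neg fun h => ha (((hc.scan i).eq_inr_iff a).1 h)]
        exact hc.setLabel l''
  | assign i is f l' =>
    obtain ⟨sim, h₁, h₂, h₃⟩ := hq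
    refine ⟨fun n c => (sim n fun j => c.arg (is j)).elim c
      fun l => (c.setCell i (.inl l)).setLabel l', ?_, ?_, ?_⟩
    · exact primrec_option_elim
        (h₁.comp .fst (Primrec.fin_curry.2 (Primrec₂.swap (Primrec.fin_curry₁.2 fun j =>
          (Sim.primrec_arg (is j)).comp .snd)))) .snd
        (Sim.primrec_setLabel.comp ((Sim.primrec_setCell i).comp (Primrec.snd.comp .fst)
          (Primrec.sumInl.comp .snd)) (.const l')).to₂
    · rintro κ κ' ⟨x, hx, y, hy, rfl⟩ n c hc
      rcases e : sim n fun j => c.arg (is j) with _ | l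
      · exact .inl rfl
      · exact .inr ((hc.setCell i (x := .inl l) (y := .inl y) (h₂ x y hy n _ (fun j => hc.arg 
          (hx j)) l e)).setLabel l')
    · rintro κ κ' ⟨x, hx, y, hy, rfl⟩ m
      obtain ⟨m', hm'⟩ := h₃ x y hy m
      -- Precision `m` is for the cells that are kept, `m'` for the arguments of `f`.
      refine ⟨max m m', fun n hn c hc => ?_⟩
      obtain ⟨l, e, hl⟩ := hm' n (le_of_max_le_right hn) _
        fun j => (hc.mono (le_max_right m m')).arg (hx j)
      rw [e]
      exact ((hc.mono (le_max_left m m')).setCell i (x := .inl l) (y := .inl y) hl).setLabel l'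
  | test is f hs hr l' l'' =>
    obtain ⟨sim, h₁, h₂, h₃⟩ := hq
    refine ⟨fun n c => (sim n fun j => c.arg (is j)).elim c
      fun l => c.setLabel (if l = [zero] then l' else l''), ?_, ?_, ?_⟩
    · exact primrec_option_elim
        (h₁.comp .fst (Primrec.fin_curry.2 (Primrec₂.swap (Primrec.fin_curry₁.2 fun j =>
          (Sim.primrec_arg (is j)).comp .snd)))) .snd
        (Sim.primrec_setLabel.comp (Primrec.snd.comp .fst) (Primrec.ite
          (Primrec.eq.comp .snd (.const _)) (.const _) (.const _))).to₂
    · rintro κ κ' ⟨x, hx, h⟩ n c hc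
      rcases e : sim n fun j => c.arg (is j) with _ | l
      · exact .inl rfl
      · refine .inr ?_
        rcases h with ⟨hy, rfl⟩ | ⟨hy, rfl⟩
        · obtain rfl : l = [zero] := h₂ x _ hy n _ (fun j => hc.arg (hx j)) l e
          simpa using hc.setLabel l'
        · obtain rfl : l = [one] := h₂ x _ hy n _ (fun j => hc.arg (hx j)) l e
          simpa [h01.symm] using hc.setLabel l''
    · rintro κ κ' ⟨x, hx, h⟩ m
      rcases h with ⟨hy, rfl⟩ | ⟨hy, rfl⟩ <;>
      · obtain ⟨m', hm'⟩ := h₃ x _ hy m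
        refine ⟨max m m', fun n hn c hc => ?_⟩
        obtain ⟨l, e, hl⟩ := hm' n (le_of_max_le_right hn) _
          fun j => (hc.mono (le_max_right m m')).arg (hx j)
        rw [e]
        first
        | obtain rfl : l = [zero] := hl
          simpa using (hc.mono (le_max_left m m')).setLabel l'
        | obtain rfl : l = [one] := hl
          simpa [h01.symm] using (hc.mono (le_max_left m m')).setLabel l''

/-- Finitely many labels allow the simulations of the statements to be combined by cases. Fixing
configurations with the final label makes it harmless to iterate too often. -/
theorem exists_stepSim [Primcodable S] [Primcodable N.Lab] [Primcodable N.Γ] (h01 : zero ≠ one)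
    (hN : ∀ l, (N.stm l).Uses fun Z Z₀ f => Approximable Z Z₀ f) :
    ∃ G : ℕ → N.Sim → N.Sim, Primrec₂ G ∧ (∀ n c, c.1 = N.final → G n c = c) ∧
      (∀ {κ κ' : N.Cfg}, N.Step κ κ' → ∀ n c, Sim.Rep 0 c κ → G n c = c ∨ Sim.Rep 0 (G n c) κ') ∧
      ∀ {κ κ' : N.Cfg}, N.Step κ κ' → ∀ m, ∃ m', ∀ n ≥ m', ∀ c, Sim.Rep m' c κ →
        Sim.Rep m (G n c) κ' := by
  classical
  have := N.finLab
  choose g hg hg' using fun l => exists_simulates h01 (N.stm l) (hN l)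
  refine ⟨fun n c => if h : c.1 = N.final then c else g ⟨c.1, h⟩ n c, ?_, ?_, ?_, ?_⟩
  · have h : Primrec₂ fun (l : N.Lab) (x : ℕ × N.Sim) =>
        if h : l = N.final then x.2 else g ⟨l, h⟩ x.1 x.2 := by
      refine primrec₂_of_finite fun l => ?_
      by_cases h : l = N.final
      · simpa [h] using Primrec.snd
      · simp only [h, dite_false]
        exact hg ⟨l, h⟩
    exact h.comp (Primrec.fst.comp .snd) .id
  · intro n c hc
    simp [hc]
  · rintro κ κ' ⟨hl, hκ⟩ n c hc
    have hl' : c.1 ≠ N.final := by rwa [hc.label]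
    simp only [hl', dite_false]
    have e : (⟨c.1, hl'⟩ : {l // l ≠ N.final}) = ⟨κ.label, hl⟩ := Subtype.ext hc.label
    rw [e]
    exact (hg' _).sound hκ n c hc
  · rintro κ κ' ⟨hl, hκ⟩ m
    obtain ⟨m', hm'⟩ := (hg' _).complete hκ m
    refine ⟨m', fun n hn c hc => ?_⟩
    have hl' : c.1 ≠ N.final := by rwa [hc.label]
    simp only [hl', dite_false]
    have e : (⟨c.1, hl'⟩ : {l // l ≠ N.final}) = ⟨κ.label, hl⟩ := Subtype.ext hc.label
    rw [e]
    exact hm' n hn c hc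

variable (N) in
/-- The initial configuration. -/
def simInit (ls : Fin k → List S) : N.Sim :=
  (N.start, fun _ => 0,
    Fin.cases [] fun i => if h : i.1 < k then [(0, .inl (ls ⟨i.1, h⟩))] else [])

theorem primrec_simInit [Primcodable S] [Primcodable N.Lab] [Primcodable N.Γ] :
    Primrec (simInit N) := by
  refine (Primrec.const _).pair ((Primrec.const _).pair
    (Primrec.fin_curry.2 (Primrec₂.swap (Primrec.fin_curry₁.2 fun i => ?_))))
  refine Fin.cases (.const _) (fun i => ?_) i
  by_cases h : i.1 < k
  · simp only [Fin.cases_succ, h, dite_true]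
    exact Primrec.list_cons.comp ((Primrec.const 0).pair (Primrec.sumInl.comp
      (Primrec.fin_app.comp .id (.const _)))) (.const [])
  · simp only [Fin.cases_succ, h, dite_false]
    exact .const _

theorem rep_simInit {m : ℕ} {ls : Fin k → List S} {x : ∀ j, Str S (Y (N.inTape j))}
    (h : ∀ j, Approx (Y (N.inTape j)) m (ls j) (x j)) :
    Sim.Rep m (simInit N ls) (N.initCfg x) := by
  refine ⟨rfl, rfl, fun i z => ?_⟩
  refine Fin.cases ?_ (fun i => ?_) i
  · exact rfl
  · by_cases hi : i.1 < k
    · simp only [simInit, initCfg, Fin.cases_succ, hi, dite_true, readCell_cons, true_and]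
      by_cases hz : z = 0
      · simp only [hz, if_true, dite_true]
        exact h ⟨i.1, hi⟩
      · simp only [hz, if_false, dite_false]
        exact rfl
    · simp only [simInit, initCfg, Fin.cases_succ, hi, dite_false, false_and]
      exact rfl

/-- One number `n` serves both as the number of simulated steps and as the effort spent on each
statement. -/
theorem fn_approximable [Primcodable S] (h01 : zero ≠ one)
    (hN : ∀ l, (N.stm l).Uses fun Z Z₀ f => Approximable Z Z₀ f) :
    Approximable (fun j => Y (N.inTape j)) (Y 0) N.fn := by
  classical
  have := N.finLab
  have := N.finΓ
  let := primcodableOfFinite N.Lab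
  let := primcodableOfFinite N.Γ
  obtain ⟨G, hG, hfin, hsound, hcomplete⟩ := exists_stepSim h01 hN
  let res : N.Sim → Option (List S) := fun c =>
    if c.1 = N.final then (readCell N.blank (c.2.2 0) 0).elim some fun _ => none else none
  have hres : Primrec res := by
    refine Primrec.ite (Primrec.eq.comp .fst (.const _)) ?_ (.const _)
    exact primrec_sum_elim ((primrec_readCell N.blank).comp
        (Primrec.fin_app.comp (Primrec.snd.comp .snd) (.const 0)) (.const 0))
      (Primrec.option_some.comp .snd).to₂ (.const _)
  refine ⟨fun n ls => res ((G n)^[n] (simInit N ls)), ?_, ?_, ?_⟩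
  · exact hres.comp (Primrec.nat_iterate .fst (primrec_simInit.comp .snd)
      (hG.comp (Primrec.fst.comp .fst) .snd).to₂)
  · intro x x₀ hx₀ n ls hls l hl
    obtain ⟨s, κ, h⟩ := exists_isRun hx₀
    -- Because of stalling, `i` iterations reach only some configuration of the run; if its label is
    -- final, it must be the last one.
    have key : ∀ i, ∃ i' ≤ s, Sim.Rep 0 ((G n)^[i] (simInit N ls)) (κ i') := by
      intro i
      induction i with
      | zero =>
        refine ⟨0, Nat.zero_le _, ?_⟩
        rw [h.init]
        exact rep_simInit hls
      | succ i ih =>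
        obtain ⟨i', hi', hrep⟩ := ih
        rw [Function.iterate_succ_apply']
        rcases hi'.eq_or_lt with rfl | hlt
        · refine ⟨i', hi', ?_⟩
          rwa [hfin _ _ (hrep.label.trans h.accepts.1)]
        · rcases hsound (h.step i' hlt) n _ hrep with e | h'
          · exact ⟨i', hi', by rwa [e]⟩
          · exact ⟨i' + 1, hlt, h'⟩
    obtain ⟨i', hi', hrep⟩ := key n
    simp only [res] at hl
    split_ifs at hl with hlab
    have : i' = s := by
      rcases hi'.eq_or_lt with e | hlt
      · exact e
      · exact absurd (hrep.label.symm.trans hlab) (h.step i' hlt).1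
    subst this
    have h₁ := hrep.tape 0 0
    rw [h.accepts.2] at h₁
    obtain ⟨l', hl', h₂⟩ := h₁.exists_inl
    rw [hl'] at hl
    obtain rfl := Option.some_inj.1 hl
    exact h₂
  · intro x x₀ hx₀ m
    obtain ⟨s, κ, h⟩ := exists_isRun hx₀
    -- The precision `m` is quantified inside the induction, since a step may demand a higher
    -- precision of the configuration before it.
    have key : ∀ i ≤ s, ∀ m, ∃ m', ∀ n ≥ m', ∀ ls : Fin k → List S,
        (∀ j, Approx (Y (N.inTape j)) m' (ls j) (x j)) →
          Sim.Rep m ((G n)^[i] (simInit N ls)) (κ i) := by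
      intro i
      induction i with
      | zero =>
        refine fun _ m => ⟨m, fun n _ ls hls => ?_⟩
        rw [h.init]
        exact rep_simInit hls
      | succ i ih =>
        intro hi m
        obtain ⟨m₁, hm₁⟩ := hcomplete (h.step i hi) m
        obtain ⟨m₂, hm₂⟩ := ih (by omega) m₁
        refine ⟨max m₁ m₂, fun n hn ls hls => ?_⟩
        rw [Function.iterate_succ_apply']
        exact hm₁ n (le_of_max_le_left hn) _ (hm₂ n (le_of_max_le_right hn) ls
          fun j => (hls j).mono (le_max_right m₁ m₂))
    obtain ⟨m', hm'⟩ := key s le_rfl m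
    refine ⟨max m' s, fun n hn ls hls => ?_⟩
    have hrep := hm' n (le_of_max_le_left hn) ls fun j => (hls j).mono (le_max_left m' s)
    have hlab := hrep.label.trans h.accepts.1
    have e : (G n)^[n] (simInit N ls) = (G n)^[s] (simInit N ls) := by
      obtain ⟨d, hd⟩ := Nat.exists_eq_add_of_le' (le_of_max_le_right hn)
      conv_lhs => rw [hd, Function.iterate_add_apply]
      rw [← hd]
      exact Function.iterate_fixed (hfin _ _ hlab) d
    have h₁ := hrep.tape 0 0
    rw [h.accepts.2] at h₁
    obtain ⟨l, hl, h₂⟩ := h₁.exists_inl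
    refine ⟨l, ?_, h₂⟩
    simp only [e, res, hlab, if_true, hl]
    rfl

end GTM
/-! Approximable partial functions are computable -/

theorem Approx.symbolAt {S : Type} {t : Kind} {m : ℕ} {l : List S} {x : Str S t}
    (h : Approx t m l x) {i : ℕ} {a : S} (ha : l[i]? = some a) : x.symbolAt i = some a := by
  cases t
  · obtain rfl : l = x := h
    simpa [Str.symbolAt] using ha
  · simp [Str.symbolAt, h.2 i a ha]

theorem Type2Machine.run_ne_none_of_le {S : Type} {n : ℕ} {M : Type2Machine S n} {Y : Fin n → Kind}
    {p : ∀ j, Str S (Y j)} {s s' : ℕ} (hs : s ≤ s') (h : M.run p s' ≠ none) : M.run p s ≠ none := by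
  induction s', hs using Nat.le_induction with
  | base => exact h
  | succ s' _ ih =>
    refine ih fun h' => h ?_
    rw [run, h']
    rfl

/-! ### The machine that evaluates better and better approximations -/

namespace Search

/-- `l` is the part of a sequence in the first `m` cells of the tape. -/
def IsRead {S : Type} : (t : Kind) → ℕ → List S → Str S t → Prop
  | .word, m, l, w => l = (w : List S).take m
  | .stream, m, l, q => l.length = m ∧ ∀ i a, l[i]? = some a → a = (q : ℕ → S) i

section IsRead

variable {S : Type} {t : Kind} {m : ℕ} {l : List S} {x : Str S t}

theorem IsRead.zero : IsRead t 0 [] x := by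
  cases t
  · exact (List.take_zero).symm
  · exact ⟨rfl, by simp⟩

theorem IsRead.succ (h : IsRead t m l x) : IsRead t (m + 1) (l ++ (x.symbolAt m).toList) x := by
  cases t
  · obtain rfl : l = (show List S from x).take m := h
    simp only [IsRead, Str.symbolAt, Int.natCast_nonneg, if_true, Int.toNat_natCast]
    exact (List.take_add_one).symm
  · simp only [IsRead, Str.symbolAt, Int.natCast_nonneg, if_true, Int.toNat_natCast]
    refine ⟨by simp [h.1], fun i a ha => ?_⟩
    rcases lt_or_ge i l.length with hi | hi
    · rw [List.getElem?_append_left hi] at ha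
      exact h.2 i a ha
    · rw [List.getElem?_append_right hi] at ha
      obtain ⟨hi', rfl⟩ := List.getElem?_eq_some_iff.1 ha
      have : i = m := by
        have := h.1
        simp at hi'
        omega
      subst this
      simp [h.1]

/-- If the first `m` cells contain fewer than `m` letters, the blank behind the word has been seen,
so the word is complete. -/
theorem IsRead.approx (h : IsRead t m l x) (hl : t = .word → l.length < m) : Approx t m l x := by
  cases t
  · obtain rfl : l = (show List S from x).take m := h
    have := hl rfl
    rw [List.length_take] at this
    exact List.take_of_length_le (by omega)
  · exact ⟨h.1.ge, h.2⟩

theorem exists_length_lt (x : Str S t) :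
    ∃ m₀, ∀ m ≥ m₀, ∀ l, IsRead t m l x → t = .word → l.length < m := by
  cases t
  · refine ⟨(show List S from x).length + 1, fun m hm l h _ => ?_⟩
    obtain rfl : l = (show List S from x).take m := h
    rw [List.length_take]
    omega
  · exact ⟨0, fun m _ l _ h => by cases h⟩

end IsRead

variable {S : Type} {n : ℕ} (Y : Fin n → Kind) (Y₀ : Kind)
  (sim : ℕ → (Fin n → List S) → Option (List S))

/-- The number of symbols read on every input tape, the symbols, and the number of symbols written
so far. -/
abbrev Memory (S : Type) (n : ℕ) : Type := ℕ × (Fin n → List S) × ℕ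

open Classical in
/-- Whether all input words have been read completely. -/
noncomputable def ready (x : Memory S n) : Bool :=
  decide (∀ j, Y j = .word → decide ((x.2.1 j).length < x.1) = true)

/-- The approximation of the result. -/
noncomputable def result (x : Memory S n) : Option (List S) :=
  if ready Y x then sim x.1 x.2.1 else none

/-- The next symbol of the output. -/
noncomputable def nextSymbol (x : Memory S n) : Option S :=
  (result Y sim x).bind fun l => l[x.2.2]?

/-- Whether the result is a word that has been written completely. -/
noncomputable def finished (x : Memory S n) : Bool :=
  match Y₀ with
  | .word => (result Y sim x).isSome && (nextSymbol Y sim x).isNone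
  | .stream => false

/-- The action of the machine. -/
noncomputable def act (x : Memory S n) : Option (Option S) :=
  if finished Y Y₀ sim x then none else some (nextSymbol Y sim x)

/-- The next contents of the memory. -/
noncomputable def next (a : Fin n → Option S) (x : Memory S n) : Memory S n :=
  (x.1 + 1, fun j => x.2.1 j ++ (a j).toList, x.2.2 + (nextSymbol Y sim x).toList.length)

section Primrec

variable [Primcodable S] {sim}

theorem primrec_ready : Primrec (ready (S := S) Y) := by
  classical
  have h : Primrec fun b : Fin n → Bool => decide (∀ j, Y j = .word → b j = true) :=
    Primrec.dom_finite _
  refine (h.comp (Primrec.fin_curry.2 (Primrec₂.mk ?_) :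
    Primrec fun (x : Memory S n) (j : Fin n) => decide ((x.2.1 j).length < x.1))).of_eq
      fun x => ?_
  · exact (Primrec.nat_lt.comp (Primrec.list_length.comp (Primrec.fin_app.comp
      (Primrec.fst.comp (Primrec.snd.comp .fst)) .snd)) (Primrec.fst.comp .fst)).decide
  · unfold ready
    congr

variable {Y Y₀}

theorem primrec_result (h : Primrec₂ sim) : Primrec (result Y sim) :=
  (Primrec.cond (primrec_ready Y) (h.comp .fst (Primrec.fst.comp .snd)) (.const none)).of_eq
    fun x => by rw [result]; cases ready Y x <;> rfl

theorem primrec_nextSymbol (h : Primrec₂ sim) : Primrec (nextSymbol Y sim) :=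
  Primrec.option_bind (primrec_result h)
    (Primrec.list_getElem?.comp .snd (Primrec.snd.comp (Primrec.snd.comp .fst))).to₂

theorem primrec_finished (h : Primrec₂ sim) : Primrec (finished Y Y₀ sim) := by
  cases Y₀
  · exact Primrec.and.comp (Primrec.option_isSome.comp (primrec_result h))
      ((Primrec.not.comp (Primrec.option_isSome.comp (primrec_nextSymbol h))).of_eq
        fun x => by cases nextSymbol Y sim x <;> rfl)
  · exact .const _

theorem primrec_act (h : Primrec₂ sim) : Primrec (act Y Y₀ sim) :=
  (Primrec.cond (primrec_finished h) (.const none)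
    (Primrec.option_some.comp (primrec_nextSymbol h))).of_eq
    fun x => by rw [act]; cases finished Y Y₀ sim x <;> rfl

theorem primrec_next (h : Primrec₂ sim) : Primrec₂ (next Y sim) := by
  refine (Primrec.succ.comp (Primrec.fst.comp .snd)).pair (.pair ?_ ?_)
  · refine Primrec.fin_curry.2 (Primrec₂.mk ?_)
    exact Primrec.list_append.comp
      (Primrec.fin_app.comp (Primrec.fst.comp (Primrec.snd.comp (Primrec.snd.comp .fst))) .snd)
      (Primrec.optionToList.comp (Primrec.fin_app.comp (Primrec.fst.comp .fst) .snd))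
  · exact Primrec.nat_add.comp (Primrec.snd.comp (Primrec.snd.comp .snd))
      (Primrec.list_length.comp (Primrec.optionToList.comp ((primrec_nextSymbol h).comp .snd)))

end Primrec

section Correctness

variable {Y Y₀ sim} (p : ∀ j, Str S (Y j))

variable (Y sim) in
/-- The contents of the memory at time `t`. -/
noncomputable def mem : ℕ → Memory S n
  | 0 => (0, fun _ => [], 0)
  | t + 1 => next Y sim (fun j => (p j).symbolAt t) (mem t)

variable (Y sim) in
/-- The output until time `t`. -/
noncomputable def out : ℕ → List S
  | 0 => []
  | t + 1 => out t ++ (nextSymbol Y sim (mem Y sim p t)).toList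

theorem mem_fst (t : ℕ) : (mem Y sim p t).1 = t := by
  induction t with
  | zero => rfl
  | succ t ih => rw [mem, next, ih]

theorem out_length (t : ℕ) : (out Y sim p t).length = (mem Y sim p t).2.2 := by
  induction t with
  | zero => rfl
  | succ t ih => rw [out, List.length_append, ih]; rfl

theorem isRead_mem (t : ℕ) (j : Fin n) : IsRead (Y j) t ((mem Y sim p t).2.1 j) (p j) := by
  induction t with
  | zero => exact .zero
  | succ t ih => exact ih.succ

theorem approx_of_ready {t : ℕ} (h : ready Y (mem Y sim p t)) (j : Fin n) :
    Approx (Y j) t ((mem Y sim p t).2.1 j) (p j) := by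
  refine (isRead_mem p t j).approx fun hj => ?_
  have := (by simpa only [ready, decide_eq_true_eq] using h :
    ∀ j, Y j = .word → ((mem Y sim p t).2.1 j).length < (mem Y sim p t).1) j hj
  rw [mem_fst] at this
  exact this

theorem exists_ready : ∃ t₀, ∀ t ≥ t₀, ready Y (mem Y sim p t) := by
  choose m₀ hm₀ using fun j => exists_length_lt (p j)
  refine ⟨Finset.univ.sup m₀, fun t ht => ?_⟩
  simp only [ready, decide_eq_true_eq, mem_fst]
  intro j hj
  exact hm₀ j t ((Finset.le_sup (Finset.mem_univ j)).trans ht) _ (isRead_mem p t j) hj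

variable {p} {y : Str S Y₀}

theorem result_sound (hsim : ∀ N ls, (∀ j, Approx (Y j) 0 (ls j) (p j)) →
      ∀ l, sim N ls = some l → Approx Y₀ 0 l y) {t : ℕ} {l : List S}
    (hl : result Y sim (mem Y sim p t) = some l) : Approx Y₀ 0 l y := by
  unfold result at hl
  split_ifs at hl with h
  exact hsim _ _ (fun j => (approx_of_ready p h j).mono (Nat.zero_le _)) l hl

theorem result_complete {m : ℕ} (hsim : ∃ m', ∀ N ≥ m', ∀ ls,
      (∀ j, Approx (Y j) m' (ls j) (p j)) → ∃ l, sim N ls = some l ∧ Approx Y₀ m l y) :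
    ∃ t₀, ∀ t ≥ t₀, ∃ l, result Y sim (mem Y sim p t) = some l ∧ Approx Y₀ m l y := by
  obtain ⟨m', h⟩ := hsim
  obtain ⟨t₀, ht₀⟩ := exists_ready (Y := Y) (sim := sim) p
  refine ⟨max m' t₀, fun t ht => ?_⟩
  have hr := ht₀ t (le_of_max_le_right ht)
  rw [result, if_pos hr]
  refine h _ ?_ _ fun j => (approx_of_ready p hr j).mono (le_of_max_le_left ht)
  rw [mem_fst]
  exact le_of_max_le_left ht

/-- Every approximation used agrees with the same `y`, so nothing written ever has to be revised.
The symbol appended is the one at the position given by the counter in memory, which equals the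
output length. Using `symbolAt` covers words and sequences at once. -/
theorem symbolAt_out (hsim : ∀ N ls, (∀ j, Approx (Y j) 0 (ls j) (p j)) →
      ∀ l, sim N ls = some l → Approx Y₀ 0 l y) (t : ℕ) {i : ℕ} {a : S}
    (ha : (out Y sim p t)[i]? = some a) : y.symbolAt i = some a := by
  induction t generalizing a with
  | zero => simp [out] at ha
  | succ t ih =>
    rw [out] at ha
    rcases lt_or_ge i (out Y sim p t).length with hi | hi
    · rw [List.getElem?_append_left hi] at ha
      exact ih ha
    · rw [List.getElem?_append_right hi] at ha
      rcases e : nextSymbol Y sim (mem Y sim p t) with _ | b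
      · simp [e] at ha
      · rw [e] at ha
        obtain ⟨hi', rfl⟩ := List.getElem?_eq_some_iff.1 ha
        simp only [Option.toList_some, List.length_singleton] at hi'
        obtain ⟨l, h₁, h₂⟩ := Option.bind_eq_some_iff.1 e
        have hil : i = (mem Y sim p t).2.2 := by
          rw [← out_length]; omega
        rw [← hil] at h₂
        simpa using (result_sound hsim h₁).symbolAt h₂

theorem out_length_mono : Monotone fun t => (out Y sim p t).length :=
  monotone_nat_of_le_succ fun t => by rw [out, List.length_append]; omega

end Correctness

end Search

open Search in
-- Soundness makes every written symbol correct; completeness makes the output grow until it is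
-- finished, or forever.
theorem Approximable.exists_machine {S : Type} [Finite S] [Primcodable S] {n : ℕ}
    {Y : Fin n → Kind} {Y₀ : Kind} {f : MultiFun (∀ j, Str S (Y j)) (Str S Y₀)}
    (hf : Approximable Y Y₀ f) : ∃ M : Type2Machine S n, ∀ p, f p ⊆ M.fn Y Y₀ p := by
  classical
  obtain ⟨sim, hprim, hsound, hcomplete⟩ := hf
  obtain ⟨M, hM⟩ := exists_driver (S := S) (n := n) (0, fun _ => [], 0)
    (act := fun _ => act Y Y₀ sim) (next := next Y sim)
    ((primrec_act hprim).to_comp.comp Computable.snd).to₂ (primrec_next hprim).to_comp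
  refine ⟨M, fun p y hy => ?_⟩
  have hs := hsound p y hy
  have hact : ∀ t, finished Y Y₀ sim (mem Y sim p t) = false →
      act Y Y₀ sim (mem Y sim p t) = some (nextSymbol Y sim (mem Y sim p t)) := fun t h => by
    simp [act, h]
  replace hM := fun T (hT : ∀ t < T, finished Y Y₀ sim (mem Y sim p t) = false) =>
    hM p (mem Y sim p) (out Y sim p) rfl rfl T
      fun t ht => ⟨rfl, _, hact t (hT t ht), rfl⟩
  have hnext : ∀ t, (nextSymbol Y sim (mem Y sim p t)).isSome →
      (out Y sim p (t + 1)).length = (out Y sim p t).length + 1 := fun t h => by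
    obtain ⟨a, ha⟩ := Option.isSome_iff_exists.1 h
    simp [out, ha]
  cases Y₀ with
  | word =>
    obtain ⟨t₀, ht₀⟩ := result_complete (hcomplete p y hy 0)
    have hfin : ∃ t, finished Y .word sim (mem Y sim p t) = true := by
      by_contra! hne
      -- From `t₀` on the result is known, so each unfinished round writes a symbol, and the output
      -- would outgrow `y`.
      have hlen : ∀ i, i ≤ (out Y sim p (t₀ + i)).length := by
        intro i
        induction i with
        | zero => exact Nat.zero_le _
        | succ i ih =>
          obtain ⟨l, hl, -⟩ := ht₀ (t₀ + i) (by omega)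
          have h₁ := hne (t₀ + i)
          rw [← Nat.add_assoc, hnext]
          · omega
          · simpa [finished, hl, Option.isSome_iff_ne_none] using h₁
      have h₁ := hlen ((show List S from y).length + 1)
      have h₂ := symbolAt_out hs _ (List.getElem?_eq_getElem h₁)
      simp only [Str.symbolAt, Int.natCast_nonneg, if_true, Int.toNat_natCast] at h₂
      exact Option.some_ne_none _ (h₂.symm.trans (List.getElem?_eq_none le_rfl))
    have hlt := fun t (ht : t < Nat.find hfin) => Bool.eq_false_iff.2 (Nat.find_min hfin ht)
    have hT := Nat.find_spec hfin
    set T := Nat.find hfin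
    obtain ⟨-, -, -, -, -, h⟩ := hM T hlt
    obtain ⟨s, c, h₁, h₂, h₃⟩ := h (by simp [act, hT])
    refine ⟨s, c, h₁, h₂, h₃.trans ?_⟩
    simp only [finished, Bool.and_eq_true, Option.isNone_iff_eq_none] at hT
    obtain ⟨l, hl⟩ := Option.isSome_iff_exists.1 hT.1
    obtain rfl : l = y := result_sound hs hl
    have h₄ := hT.2
    simp only [nextSymbol, hl, Option.bind_some, ← out_length, List.getElem?_eq_none_iff] at h₄
    -- The output agrees with `y` as far as it goes, and `h₄` says that it is at least as long.
    refine List.ext_getElem? fun i => ?_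
    rcases lt_or_ge i (out Y sim p T).length with hi | hi
    · rw [List.getElem?_eq_getElem hi]
      have := symbolAt_out hs T (List.getElem?_eq_getElem hi)
      simpa [Str.symbolAt] using this.symm
    · rw [List.getElem?_eq_none hi, List.getElem?_eq_none (h₄.trans hi)]
  | stream =>
    replace hM := fun T => hM T fun _ _ => rfl
    refine ⟨fun s => ?_, fun m => ?_⟩
    · obtain ⟨s', c, h₁, h₂, -⟩ := hM s
      exact Type2Machine.run_ne_none_of_le h₁ (by simp [h₂])
    · have hlen : ∀ m, ∃ t, m ≤ (out Y sim p t).length := by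
        intro m
        induction m with
        | zero => exact ⟨0, Nat.zero_le _⟩
        | succ m ih =>
          obtain ⟨t, ht⟩ := ih
          obtain ⟨t₀, ht₀⟩ := result_complete (hcomplete p y hy (m + 1))
          have h₁ := out_length_mono (Y := Y) (sim := sim) (p := p) (le_max_left t t₀)
          obtain ⟨l, hl, h₂⟩ := ht₀ _ (le_max_right t t₀)
          by_cases h₃ : m + 1 ≤ (out Y sim p (max t t₀)).length
          · exact ⟨_, h₃⟩
          · refine ⟨max t t₀ + 1, ?_⟩
            simp only at h₁
            rw [hnext]
            · omega
            · have := h₂.1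
              simp only [nextSymbol, hl, Option.bind_some, ← out_length]
              rw [List.getElem?_eq_getElem (by omega)]
              rfl
      obtain ⟨T, hT⟩ := hlen (m + 1)
      obtain ⟨s, c, -, h₁, h₂, -⟩ := hM T
      refine ⟨s, c, h₁, ?_⟩
      rw [h₂]
      have h₃ := List.getElem?_eq_getElem (show m < (out Y sim p T).length from hT)
      have h₄ := symbolAt_out hs T h₃
      rw [h₃, ← h₄]
      simp [Str.symbolAt]

theorem Approximable.isComputable {S : Type} [Finite S] [Primcodable S] {n : ℕ}
    {Y : Fin n → Kind} {Y₀ : Kind} {f : MultiFun (∀ j, Str S (Y j)) (Str S Y₀)}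
    (hf : Approximable Y Y₀ f) (hs : f.SingleValued) : IsComputable Y Y₀ f := by
  obtain ⟨M, hM⟩ := hf.exists_machine
  exact ⟨hs, _, ⟨M, rfl⟩, hM⟩

end GenTM

theorem mainTheorem7 {S : Type} [Finite S] (zero one : S) (h01 : zero ≠ one) (k L : ℕ)
    (Y : Fin (L + 1) → GenTM.Kind)
    (N : GenTM.GTM zero one k L (fun i => GenTM.Str S (Y i))) :
    ((∀ l, (N.stm l).Uses (fun _ _ f => f.IsContinuous)) → N.fn.IsContinuous) ∧
    ((∀ l, (N.stm l).Uses (fun Z Z₀ f => GenTM.IsComputable Z Z₀ f)) →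
      GenTM.IsComputable (fun j => Y (N.inTape j)) (Y 0) N.fn) := by
  refine ⟨GenTM.GTM.fn_isContinuous h01, fun hN => ?_⟩
  let := GenTM.primcodableOfFinite S
  exact (GenTM.GTM.fn_approximable h01 fun l => (hN l).mono fun _ _ _ hf =>
    hf.approximable).isComputable (GenTM.GTM.fn_singleValued h01 fun l =>
      (hN l).mono fun _ _ _ hf => hf.1)
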